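/- **Conventions.** Operads are coloured and non-symmetric. A simplicial operad is an operad enriched in simplicial sets, i.e. a simplicial object $\mathcal K_\bullet$ in operads all of whose simplicial operators are the identity on colours; for colours $\underline x=(x_1,\dots,x_k)$ and $y$ one has a simplicial set $\mathcal K(\underline x;y)$ of operations. Let $\pi_0[\mathcal K]_1$ be the category whose objects are the colours of $\mathcal K$ and whose morphisms $x\to y$ are the connected components of $\mathcal K(x;y)$. In the model structure on simplicial operads, a morphism $\varphi:\mathcal K\to\mathcal Q$ is * a weak equivalence if all maps $\mathcal K(\underline x;y)\to\mathcal Q(\varphi\underline x;\varphi y)$ are weak equivalences of simplicial sets and $\pi_0[\varphi]_1$ is an equivalence of categories; * a fibration if all these maps are Kan fibrations and $\pi_0[\varphi]_1$ is an isofibration; * a cofibration if it has the left lifting property against all morphisms that are both fibrations and weak equivalences. Let $\Delta_+$ be the category of finite (possibly empty) ordinals and monotone maps, and let $\alpha=(A_0\xrightarrow{\alpha_1}A_1\to\dots\xrightarrow{\alpha_n}A_n)$ be an $n$-simplex of its nerve $N(\Delta_+)$, with composites $\alpha_{i,j}:A_i\to A_j$ for $i\le j$. Preimages $\alpha_{i,j}^{-1}(a)$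 are regarded as increasing sequences. **The operad $T_\alpha$.** It has colours $\coprod_{i=0}^nA_i$ and is freely generated by operations $p_i^{(a)}:\alpha_i^{-1}(a)\to a$ for $1\le i\le n$ and $a\in A_i$. For $i\le j$ and $a\in A_j$ let $p_{i,j}^{(a)}:\alpha_{i,j}^{-1}(a)\to a$ be the evident composite of generators, with $p_{i,i}^{(a)}=1_a$. We regard $T_\alpha$ as a simplicial operad with discrete spaces of operations. **The simplicial operad $\mathbb V_\alpha$.** For $m\ge0$ let $\mathbb\Delta^n_m$ be the category with objects $0,\dots,n$ in which a morphism $i\to j$ is a chain $U_0\subseteq\dots\subseteq U_m$ of subsets of $\{i,\dots,j\}$ that contain $i$ and $j$ (there is none if $i>j$), with composition given by unions; for varying $m$ this is the simplicial thickening of $[n]$. Let $\mathbb U_\alpha[k,m]$ be the set of pairs $(\theta,a)$ with $\theta:[k]\to\mathbb\Delta^n_m$ a functor and $a\in A_{\theta(k)}$. It is simplicial in $m$. For fixed $m$, a map $\eta:[l]\to[k]$ sends $(\theta,a)$ to the finite sequence $\eta^*(\theta,a)$ of all $(\theta\eta,b)$ with $b\in A_{\theta\eta(l)}$ and $\alpha_{\theta\eta(l),\theta(k)}(b)=a$.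 This makes $\mathbb U_\alpha^{(m)}=\mathbb U_\alpha[-,m]$ a simplicial list (a simplicial object in the category of sets and maps $X\to\coprod_r Y^r$) in which $\eta^*$ is single-valued whenever $\eta(l)=k$. For such an operadic simplicial list $X$, the operad $\tau_1X$ has colours $X_0$, a generator $g:d_1g\to d_0g$ for every $g\in X_1$, and the relations $s_0x=1_x$ for $x\in X_0$ and $d_1\sigma=d_0\sigma\circ d_2\sigma$ for $\sigma\in X_2$. Since $\mathbb U_\alpha[0,m]\cong\coprod_iA_i$ for all $m$, applying $\tau_1$ for every $m$ gives a simplicial operad $\mathbb V_\alpha=\tau_1\mathbb U_\alpha$ with colours $\coprod_iA_i$. **Theorem.** For every $n\ge0$ and every $\alpha\in N(\Delta_+)_n$: 1. the simplicial operad $\mathbb V_\alpha$ is cofibrant (the morphism from the initial simplicial operad to it is a cofibration); 2. the morphism of simplicial operads $\mathbb V_\alpha\to T_\alpha$ that is the identity on colours and sends a generator $(\theta,a)\in\mathbb U_\alpha[1,m]$ to $p_{\theta(0),\theta(1)}^{(a)}$ is a weak equivalence. Thus $\mathbb V_\alpha$ is a cofibrant replacement of $T_\alpha$. -/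

import Mathlib

open CategoryTheory Opposite HomotopicalAlgebra

universe u v

/-- A coloured non-symmetric operad with set of colours `C`. All operations are collected in one
type `Op`; an operation `f` has a finite sequence `src f` of input colours and an output colour
`tgt f`. The composite `comp g fs` is defined whenever the sequence of outputs of `fs` is the
sequence of inputs of `g`. -/
structure Operad (C : Type u) where
  Op : Type u
  src : Op → List C
  tgt : Op → C
  one : C → Op
  comp (g : Op) (fs : List Op) (h : fs.map tgt = src g) : Op
  src_one (a : C) : src (one a) = [a]
  tgt_one (a : C) : tgt (one a) = a
  src_comp (g : Op) (fs : List Op) (h : fs.map tgt = src g) :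
    src (comp g fs h) = fs.flatMap src
  tgt_comp (g : Op) (fs : List Op) (h : fs.map tgt = src g) : tgt (comp g fs h) = tgt g
  one_comp (f : Op) : comp (one (tgt f)) [f] (by simp [src_one]) = f
  comp_one (f : Op) :
    comp f ((src f).map one) (by simp [Function.comp_def, tgt_one]) = f
  /-- Associativity, for a list `L` of composable pairs. -/
  assoc (g : Op) (L : List (Σ' (f : Op) (hs : List Op), hs.map tgt = src f))
    (h : (L.map fun p => p.1).map tgt = src g) :
    comp g (L.map fun p => comp p.1 p.2.1 p.2.2)
        (by rw [← h]; simp [Function.comp_def, tgt_comp]) =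
      comp (comp g (L.map fun p => p.1) h) (L.flatMap fun p => p.2.1)
        (by
          rw [src_comp, List.map_flatMap, List.flatMap_map]
          exact congrArg (fun F => L.flatMap F) (funext fun p => p.2.2))

namespace Operad

/-- A morphism of operads with underlying function on colours `φ`. -/
@[ext]
structure OverHom {C : Type u} {D : Type v} (φ : C → D) (P : Operad C) (Q : Operad D) where
  toFun : P.Op → Q.Op
  src_toFun (f : P.Op) : Q.src (toFun f) = (P.src f).map φ
  tgt_toFun (f : P.Op) : Q.tgt (toFun f) = φ (P.tgt f)
  map_one (a : C) : toFun (P.one a) = Q.one (φ a)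
  map_comp (g : P.Op) (fs : List P.Op) (h : fs.map P.tgt = P.src g) :
    toFun (P.comp g fs h) = Q.comp (toFun g) (fs.map toFun)
      (by rw [src_toFun, ← h]; simp [Function.comp_def, tgt_toFun])

theorem comp_congr {C : Type u} (P : Operad C) {g g' : P.Op} {fs fs' : List P.Op}
    (hg : g = g') (hfs : fs = fs') (h : fs.map P.tgt = P.src g)
    (h' : fs'.map P.tgt = P.src g') : P.comp g fs h = P.comp g' fs' h' := by
  subst hg hfs; rfl

/-- The identity morphism. -/
def OverHom.refl {C : Type u} (P : Operad C) : OverHom id P P where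
  toFun f := f
  src_toFun f := by simp
  tgt_toFun f := rfl
  map_one a := rfl
  map_comp g fs h := P.comp_congr rfl (by simp) _ _

/-- The composite of two morphisms, `F` followed by `G`. The colour map of the composite is allowed
to be any function `χ` equal to `ψ ∘ φ`. -/
def OverHom.trans {C D E : Type u} {φ : C → D} {ψ : D → E} {P : Operad C} {Q : Operad D}
    {R : Operad E} (F : OverHom φ P Q) (G : OverHom ψ Q R) (χ : C → E) (hχ : ψ ∘ φ = χ) :
    OverHom χ P R where
  toFun f := G.toFun (F.toFun f)
  src_toFun f := by rw [G.src_toFun, F.src_toFun, List.map_map, hχ]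
  tgt_toFun f := by rw [G.tgt_toFun, F.tgt_toFun, ← hχ]; rfl
  map_one a := by rw [F.map_one, G.map_one, ← hχ]; rfl
  map_comp g fs h := by
    rw [F.map_comp, G.map_comp]
    exact R.comp_congr rfl (by simp [Function.comp_def]) _ _

/-- Operads with set of colours `C` and identity-on-colours morphisms. -/
instance {C : Type u} : Category (Operad C) where
  Hom P Q := OverHom id P Q
  id P := OverHom.refl P
  comp F G := OverHom.trans F G id rfl

theorem id_toFun {C : Type u} (P : Operad C) (f : P.Op) :
    OverHom.toFun (𝟙 P : P ⟶ P) f = f := rfl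

theorem comp_toFun {C : Type u} {P Q R : Operad C} (F : P ⟶ Q) (G : Q ⟶ R) (f : P.Op) :
    OverHom.toFun (F ≫ G : P ⟶ R) f = OverHom.toFun G (OverHom.toFun F f) := rfl

end Operad

/-- A simplicial operad (an operad enriched in simplicial sets), presented as a simplicial object
in operads whose simplicial operators are identities on colours: the operations of `level.obj [m]`
are the `m`-simplices of the spaces of operations. -/
structure SimplicialOperad where
  Col : Type u
  level : SimplicialObject (Operad Col)

namespace SimplicialOperad

/-- The action of a simplicial operator on the simplices of the spaces of operations. -/
def act (K : SimplicialOperad.{u}) {m m' : SimplexCategoryᵒᵖ} (θ : m ⟶ m')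
    (f : (K.level.obj m).Op) : (K.level.obj m').Op :=
  Operad.OverHom.toFun (K.level.map θ) f

section

variable (K : SimplicialOperad.{u}) {m m' m'' : SimplexCategoryᵒᵖ}

theorem src_act (θ : m ⟶ m') (f : (K.level.obj m).Op) :
    (K.level.obj m').src (K.act θ f) = (K.level.obj m).src f :=
  (Operad.OverHom.src_toFun (K.level.map θ) f).trans (List.map_id _)

theorem tgt_act (θ : m ⟶ m') (f : (K.level.obj m).Op) :
    (K.level.obj m').tgt (K.act θ f) = (K.level.obj m).tgt f :=
  Operad.OverHom.tgt_toFun (K.level.map θ) f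

theorem act_id (f : (K.level.obj m).Op) : K.act (𝟙 m) f = f := by
  unfold act; rw [K.level.map_id]; rfl

theorem act_comp (θ : m ⟶ m') (θ' : m' ⟶ m'') (f : (K.level.obj m).Op) :
    K.act (θ ≫ θ') f = K.act θ' (K.act θ f) := by
  unfold act; rw [K.level.map_comp]; rfl

theorem act_one (θ : m ⟶ m') (a : K.Col) :
    K.act θ ((K.level.obj m).one a) = (K.level.obj m').one a :=
  Operad.OverHom.map_one (K.level.map θ) a

theorem act_opComp (θ : m ⟶ m') (g : (K.level.obj m).Op) (fs : List (K.level.obj m).Op)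
    (h : fs.map (K.level.obj m).tgt = (K.level.obj m).src g) :
    K.act θ ((K.level.obj m).comp g fs h) = (K.level.obj m').comp (K.act θ g) (fs.map (K.act θ))
      (by rw [src_act, ← h]; simp [Function.comp_def, tgt_act]) :=
  Operad.OverHom.map_comp (K.level.map θ) g fs h

end

/-- Morphisms of simplicial operads. -/
@[ext]
structure Hom (K Q : SimplicialOperad.{u}) where
  col : K.Col → Q.Col
  app (m : SimplexCategoryᵒᵖ) : Operad.OverHom col (K.level.obj m) (Q.level.obj m)
  naturality {m m' : SimplexCategoryᵒᵖ} (θ : m ⟶ m') (f : (K.level.obj m).Op) :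
    Q.act θ ((app m).toFun f) = (app m').toFun (K.act θ f)

instance : Category SimplicialOperad.{u} where
  Hom := Hom
  id K :=
    { col := id
      app := fun m => Operad.OverHom.refl _
      naturality := fun _ _ => rfl }
  comp φ ψ :=
    { col := ψ.col ∘ φ.col
      app := fun m => (φ.app m).trans (ψ.app m) _ rfl
      naturality := fun θ f => (ψ.naturality θ _).trans
        (congrArg (ψ.app _).toFun (φ.naturality θ f)) }

/-- The simplicial set `K(x₁, …, xₖ; y)` of operations with inputs `x` and output `y`. -/
def space (K : SimplicialOperad.{u}) (x : List K.Col) (y : K.Col) : SSet.{u} where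
  obj m := {f : (K.level.obj m).Op // (K.level.obj m).src f = x ∧ (K.level.obj m).tgt f = y}
  map θ := ↾fun f => ⟨K.act θ f.1, (K.src_act θ f.1).trans f.2.1, (K.tgt_act θ f.1).trans f.2.2⟩
  map_id m := by
    apply ConcreteCategory.hom_ext
    exact fun f => Subtype.ext (K.act_id f.1)
  map_comp θ θ' := by
    apply ConcreteCategory.hom_ext
    exact fun f => Subtype.ext (K.act_comp θ θ' f.1)

/-- The map `K(x; y) → Q(φ x; φ y)` induced by a morphism `φ`. -/
def Hom.mapSpace {K Q : SimplicialOperad.{u}} (φ : Hom K Q) (x : List K.Col) (y : K.Col) :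
    K.space x y ⟶ Q.space (x.map φ.col) (φ.col y) where
  app m := ↾fun f => ⟨(φ.app m).toFun f.1,
    by rw [(φ.app m).src_toFun, f.2.1], by rw [(φ.app m).tgt_toFun, f.2.2]⟩
  naturality m m' θ := by ext f; exact Subtype.ext (φ.naturality θ f.1).symm

/-- Composition of unary operations, on `m`-simplices. -/
def unaryComp (K : SimplicialOperad.{u}) {a b c : K.Col} {m : SimplexCategoryᵒᵖ}
    (f : (K.space [a] b).obj m) (g : (K.space [b] c).obj m) : (K.space [a] c).obj m :=
  ⟨(K.level.obj m).comp g.1 [f.1] (by rw [g.2.1, List.map_singleton, f.2.2]),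
    by rw [Operad.src_comp]; simp [f.2.1], by rw [Operad.tgt_comp]; exact g.2.2⟩

theorem map_unaryComp (K : SimplicialOperad.{u}) {a b c : K.Col} {m m' : SimplexCategoryᵒᵖ}
    (θ : m ⟶ m') (f : (K.space [a] b).obj m) (g : (K.space [b] c).obj m) :
    (K.space [a] c).map θ (K.unaryComp f g) =
      K.unaryComp ((K.space [a] b).map θ f) ((K.space [b] c).map θ g) :=
  Subtype.ext (K.act_opComp θ g.1 [f.1] _)

theorem unaryComp_assoc (K : SimplicialOperad.{u}) {a b c d : K.Col} {m : SimplexCategoryᵒᵖ}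
    (f : (K.space [a] b).obj m) (g : (K.space [b] c).obj m) (h : (K.space [c] d).obj m) :
    K.unaryComp (K.unaryComp f g) h = K.unaryComp f (K.unaryComp g h) :=
  Subtype.ext ((K.level.obj m).assoc h.1
    [⟨g.1, [f.1], by rw [g.2.1, List.map_singleton, f.2.2]⟩]
    (by rw [h.2.1]; simp [g.2.2]))

/-- The identity of the colour `a`, as an `m`-simplex. -/
def unaryOne (K : SimplicialOperad.{u}) (a : K.Col) (m : SimplexCategoryᵒᵖ) :
    (K.space [a] a).obj m :=
  ⟨(K.level.obj m).one a, Operad.src_one _ a, Operad.tgt_one _ a⟩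

theorem unaryOne_comp (K : SimplicialOperad.{u}) {a b : K.Col} {m : SimplexCategoryᵒᵖ}
    (f : (K.space [a] b).obj m) : K.unaryComp (K.unaryOne a m) f = f := by
  refine Subtype.ext (Eq.trans ?_ ((K.level.obj m).comp_one f.1))
  exact Operad.comp_congr _ rfl (by rw [f.2.1]; rfl) _ _

theorem comp_unaryOne (K : SimplicialOperad.{u}) {a b : K.Col} {m : SimplexCategoryᵒᵖ}
    (f : (K.space [a] b).obj m) : K.unaryComp f (K.unaryOne b m) = f := by
  refine Subtype.ext (Eq.trans ?_ ((K.level.obj m).one_comp f.1))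
  exact Operad.comp_congr _ (by rw [f.2.2]; rfl) rfl _ _

/-- Composition of unary operations on connected components. -/
def compπ₀ (K : SimplicialOperad.{u}) {a b c : K.Col} (p : SSet.π₀ (K.space [a] b))
    (q : SSet.π₀ (K.space [b] c)) : SSet.π₀ (K.space [a] c) :=
  SSet.π₀.lift
    (fun f => SSet.π₀.lift (fun g => SSet.π₀.mk (K.unaryComp f g))
      (fun g₀ g₁ e => SSet.π₀.sound
        (SSet.Edge.mk (K.unaryComp ((K.space [a] b).σ 0 f) e.edge)
          (by
            have h := K.map_unaryComp (SimplexCategory.δ 1).op ((K.space [a] b).σ 0 f) e.edge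
            refine h.trans ?_
            congr 1
            · exact SSet.δ_comp_σ_succ_apply (0 : Fin 1) f
            · exact e.src_eq)
          (by
            have h := K.map_unaryComp (SimplexCategory.δ 0).op ((K.space [a] b).σ 0 f) e.edge
            refine h.trans ?_
            congr 1
            · exact SSet.δ_comp_σ_self_apply (0 : Fin 1) f
            · exact e.tgt_eq))) q)
    (fun f₀ f₁ e => by
      induction q with
      | mk g =>
        exact SSet.π₀.sound
          (SSet.Edge.mk (K.unaryComp e.edge ((K.space [b] c).σ 0 g))
            (by
              have h := K.map_unaryComp (SimplexCategory.δ 1).op e.edge ((K.space [b] c).σ 0 g)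
              refine h.trans ?_
              congr 1
              · exact e.src_eq
              · exact SSet.δ_comp_σ_succ_apply (0 : Fin 1) g)
            (by
              have h := K.map_unaryComp (SimplexCategory.δ 0).op e.edge ((K.space [b] c).σ 0 g)
              refine h.trans ?_
              congr 1
              · exact e.tgt_eq
              · exact SSet.δ_comp_σ_self_apply (0 : Fin 1) g))) p

/-- The category `π₀[K]₁`: its objects are the colours of `K` and its morphisms are the connected
components of the spaces of unary operations. -/
structure HoCat (K : SimplicialOperad.{u}) where
  col : K.Col

instance (K : SimplicialOperad.{u}) : Category (HoCat K) where
  Hom a b := SSet.π₀ (K.space [a.col] b.col)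
  id a := SSet.π₀.mk (K.unaryOne a.col _)
  comp f g := K.compπ₀ f g
  id_comp f := by
    induction f with
    | mk f => exact congrArg SSet.π₀.mk (K.unaryOne_comp f)
  comp_id f := by
    induction f with
    | mk f => exact congrArg SSet.π₀.mk (K.comp_unaryOne f)
  assoc f g h := by
    induction f with
    | mk f =>
      induction g with
      | mk g =>
        induction h with
        | mk h => exact congrArg SSet.π₀.mk (K.unaryComp_assoc f g h)

/-- The functor `π₀[φ]₁`. -/
def Hom.hoFunctor {K Q : SimplicialOperad.{u}} (φ : Hom K Q) : HoCat K ⥤ HoCat Q where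
  obj a := ⟨φ.col a.col⟩
  map {a b} f := SSet.mapπ₀ (φ.mapSpace [a.col] b.col) f
  map_id a := congrArg SSet.π₀.mk (Subtype.ext ((φ.app _).map_one a.col))
  map_comp {a b c} f g := by
    change SSet.π₀ (K.space [a.col] b.col) at f
    change SSet.π₀ (K.space [b.col] c.col) at g
    induction f with
    | mk f =>
      induction g with
      | mk g => exact congrArg SSet.π₀.mk (Subtype.ext ((φ.app _).map_comp g.1 [f.1] _))

end SimplicialOperad

/-- A functor is an isofibration if every isomorphism `F a ≅ b` lifts to an isomorphism
with source `a`. -/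
def IsIsofibration {A : Type u} [Category.{v} A] {B : Type u} [Category.{v} B] (F : A ⥤ B) :
    Prop :=
  ∀ (a : A) (b : B) (e : F.obj a ≅ b), ∃ (a' : A) (e' : a ≅ a') (h : F.obj a' = b),
    F.map e'.hom ≫ eqToHom h = e.hom

/-- Weak equivalences of simplicial sets (for the Kan–Quillen model structure), defined as Quillen
does, from Kan fibrations: a map is a weak equivalence if it factors as a map with the left lifting
property against all Kan fibrations followed by a map with the right lifting property against all
boundary inclusions `∂Δ[n] ⟶ Δ[n]`. -/
def SSet.IsWeakEquivalence {X Y : SSet.{u}} (f : X ⟶ Y) : Prop :=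
  ∃ (Z : SSet.{u}) (i : X ⟶ Z) (p : Z ⟶ Y),
    SSet.anodyneExtensions i ∧ SSet.modelCategoryQuillen.I.rlp p ∧ i ≫ p = f

/-- Kan fibrations of simplicial sets: the right lifting property against all horn inclusions. -/
def SSet.IsKanFibration {X Y : SSet.{u}} (f : X ⟶ Y) : Prop :=
  SSet.modelCategoryQuillen.J.rlp f

namespace SimplicialOperad

/-- Weak equivalences of the model structure on simplicial operads. -/
instance : CategoryWithWeakEquivalences SimplicialOperad.{u} where
  weakEquivalences K _ φ :=
    (∀ (x : List K.Col) (y : K.Col), SSet.IsWeakEquivalence (Hom.mapSpace φ x y)) ∧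
      (Hom.hoFunctor φ).IsEquivalence

/-- Fibrations of the model structure on simplicial operads. -/
instance : CategoryWithFibrations SimplicialOperad.{u} where
  fibrations K _ φ :=
    (∀ (x : List K.Col) (y : K.Col), SSet.IsKanFibration (Hom.mapSpace φ x y)) ∧
      IsIsofibration (Hom.hoFunctor φ)

/-- Cofibrations of the model structure on simplicial operads: the left lifting property against
all trivial fibrations. -/
instance : CategoryWithCofibrations SimplicialOperad.{u} where
  cofibrations := (trivialFibrations SimplicialOperad.{u}).llp

/-- The operad without colours. -/
def emptyOperad : Operad PEmpty.{u + 1} where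
  Op := PEmpty
  src f := f.elim
  tgt f := f
  one a := a
  comp g _ _ := g
  src_one a := a.elim
  tgt_one a := a.elim
  src_comp g := g.elim
  tgt_comp g := g.elim
  one_comp g := g.elim
  comp_one g := g.elim
  assoc g := g.elim

/-- The simplicial operad without colours is initial. -/
def emptyIsInitial :
    Limits.IsInitial (⟨PEmpty, (Functor.const _).obj emptyOperad⟩ : SimplicialOperad.{u}) :=
  Limits.IsInitial.ofUniqueHom
    (fun K =>
      { col := fun a => a.elim
        app := fun _ =>
          { toFun := fun f => PEmpty.elim f
            src_toFun := fun f => PEmpty.elim f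
            tgt_toFun := fun f => PEmpty.elim f
            map_one := fun a => a.elim
            map_comp := fun g => PEmpty.elim g }
        naturality := fun _ f => PEmpty.elim f })
    (fun K φ => by
      obtain ⟨c, a, n⟩ := φ
      have hc : c = fun a => a.elim := funext fun a => a.elim
      subst hc
      congr 1
      funext m
      apply Operad.OverHom.ext
      funext f
      exact PEmpty.elim f)

instance : Limits.HasInitial SimplicialOperad.{u} := emptyIsInitial.hasInitial

/-- An operad, regarded as a simplicial operad with discrete spaces of operations. -/
def discrete {C : Type u} (P : Operad C) : SimplicialOperad.{u} where
  Col := C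
  level := (Functor.const _).obj P

end SimplicialOperad

/-- Generators and relations for an operad with set of colours `C`: generating operations `Gen`
with inputs and output, relations `g = 1_a` for `IsUnit g a`, and relations `h = g ∘ fs` for
`IsComp g fs h`. -/
structure OperadPresentation (C : Type u) where
  Gen : Type u
  src : Gen → List C
  tgt : Gen → C
  IsUnit : Gen → C → Prop
  IsComp : Gen → List Gen → Gen → Prop
  src_of_isUnit {g : Gen} {a : C} : IsUnit g a → src g = [a]
  tgt_of_isUnit {g : Gen} {a : C} : IsUnit g a → tgt g = a
  map_tgt_of_isComp {g : Gen} {fs : List Gen} {h : Gen} : IsComp g fs h → fs.map tgt = src g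
  src_of_isComp {g : Gen} {fs : List Gen} {h : Gen} : IsComp g fs h → src h = fs.flatMap src
  tgt_of_isComp {g : Gen} {fs : List Gen} {h : Gen} : IsComp g fs h → tgt h = tgt g

namespace OperadPresentation

/-- Formal composites of the generators. -/
inductive Term {C : Type u} (M : OperadPresentation C) : Type u
  | one (a : C) : Term M
  | gen (g : M.Gen) : Term M
  | comp (t : Term M) (ts : List (Term M)) : Term M

variable {C : Type u} (M : OperadPresentation C)

namespace Term

variable {M}

/-- The output of a formal composite. -/
def tgt : Term M → C
  | one a => a
  | gen g => M.tgt g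
  | comp t _ => t.tgt

mutual
/-- The inputs of a formal composite. -/
def src : Term M → List C
  | one a => [a]
  | gen g => M.src g
  | comp _ ts => srcs ts
/-- The inputs of a list of formal composites. -/
def srcs : List (Term M) → List C
  | [] => []
  | t :: ts => t.src ++ srcs ts
end

theorem srcs_eq (ts : List (Term M)) : srcs ts = ts.flatMap src := by
  induction ts with
  | nil => rfl
  | cons t ts ih => simp [srcs, ih]

theorem src_comp (t : Term M) (ts : List (Term M)) : (comp t ts).src = ts.flatMap src := by
  rw [src, srcs_eq]

end Term

open Term in
/-- The congruence generated by the relations and the operad axioms. It is a partial equivalence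
relation: `Rel t t` holds exactly when `t` is a well-formed formal composite. -/
inductive Rel : Term M → Term M → Prop
  | one (a : C) : Rel (one a) (one a)
  | gen (g : M.Gen) : Rel (gen g) (gen g)
  | comp {t t' : Term M} (L : List (Term M × Term M)) : Rel t t' → (∀ p ∈ L, Rel p.1 p.2) →
      L.map (fun p => p.1.tgt) = t.src →
      Rel (comp t (L.map fun p => p.1)) (comp t' (L.map fun p => p.2))
  | symm {t t' : Term M} : Rel t t' → Rel t' t
  | trans {t t' t'' : Term M} : Rel t t' → Rel t' t'' → Rel t t''
  | one_comp {t : Term M} : Rel t t → Rel (comp (one t.tgt) [t]) t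
  | comp_one {t : Term M} : Rel t t → Rel (comp t (t.src.map one)) t
  | assoc {t : Term M} (L : List (Term M × List (Term M))) : Rel t t → (∀ p ∈ L, Rel p.1 p.1) →
      (∀ p ∈ L, ∀ s ∈ p.2, Rel s s) → (∀ p ∈ L, p.2.map Term.tgt = p.1.src) →
      L.map (fun p => p.1.tgt) = t.src →
      Rel (comp t (L.map fun p => comp p.1 p.2))
        (comp (comp t (L.map fun p => p.1)) (L.flatMap fun p => p.2))
  | unit {g : M.Gen} {a : C} : M.IsUnit g a → Rel (gen g) (one a)
  | composite {g : M.Gen} {fs : List M.Gen} {h : M.Gen} : M.IsComp g fs h →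
      Rel (comp (gen g) (fs.map gen)) (gen h)

namespace Rel

variable {M}

theorem tgt_eq {t t' : Term M} (h : Rel M t t') : t.tgt = t'.tgt := by
  induction h with
  | one a => rfl
  | gen g => rfl
  | comp L _ _ _ ih _ => exact ih
  | symm _ ih => exact ih.symm
  | trans _ _ ih ih' => exact ih.trans ih'
  | one_comp _ _ => rfl
  | comp_one _ _ => rfl
  | assoc L _ _ _ _ _ _ _ _ => rfl
  | unit h => exact M.tgt_of_isUnit h
  | composite h => exact (M.tgt_of_isComp h).symm

theorem src_eq {t t' : Term M} (h : Rel M t t') : t.src = t'.src := by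
  induction h with
  | one a => rfl
  | gen g => rfl
  | comp L _ _ _ _ ih =>
    rw [Term.src_comp, Term.src_comp, List.flatMap_map, List.flatMap_map]
    exact List.flatMap_congr ih
  | symm _ ih => exact ih.symm
  | trans _ _ ih ih' => exact ih.trans ih'
  | one_comp _ _ => simp [Term.src_comp]
  | comp_one _ _ => rw [Term.src_comp, List.flatMap_map]; simp [Term.src]
  | assoc L _ _ _ _ _ _ _ _ =>
    simp [Term.src_comp, List.flatMap_map, List.flatMap_assoc]
  | unit h => exact M.src_of_isUnit h
  | composite h =>
    rw [Term.src_comp, List.flatMap_map]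
    exact (M.src_of_isComp h).symm

theorem left {t t' : Term M} (h : Rel M t t') : Rel M t t := h.trans h.symm

theorem comp_self {t : Term M} {ts : List (Term M)} (ht : Rel M t t) (hts : ∀ s ∈ ts, Rel M s s)
    (h : ts.map Term.tgt = t.src) : Rel M (.comp t ts) (.comp t ts) := by
  have := Rel.comp (M := M) (ts.map fun s => (s, s)) ht (by simpa using hts)
    (by simpa [Function.comp_def] using h)
  simpa [Function.comp_def] using this

end Rel

/-- Well-formed formal composites up to the congruence. -/
def setoid : Setoid {t : Term M // Rel M t t} where
  r t t' := Rel M t.1 t'.1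
  iseqv := ⟨fun t => t.2, fun h => h.symm, fun h h' => h.trans h'⟩

/-- The operations of the presented operad. -/
def Operations : Type u := Quotient M.setoid

namespace Operations

variable {M}

/-- The operation represented by a well-formed formal composite. -/
def mk (t : Term M) (h : Rel M t t) : M.Operations := Quotient.mk M.setoid ⟨t, h⟩

theorem mk_eq {t t' : Term M} (h : Rel M t t') : mk t h.left = mk t' h.symm.left :=
  Quotient.sound (s := M.setoid) h

/-- A representative of an operation. -/
noncomputable def out (x : M.Operations) : Term M := (Quotient.out (s := M.setoid) x).1

theorem rel_out (x : M.Operations) : Rel M x.out x.out := (Quotient.out (s := M.setoid) x).2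

theorem mk_out (x : M.Operations) : mk x.out x.rel_out = x := Quotient.out_eq (s := M.setoid) x

theorem out_mk {t : Term M} (h : Rel M t t) : Rel M (mk t h).out t :=
  Quotient.mk_out (s := M.setoid) ⟨t, h⟩

theorem eq_of_rel {x y : M.Operations} (h : Rel M x.out y.out) : x = y := by
  rw [← x.mk_out, ← y.mk_out]; exact mk_eq h

end Operations

/-- The operad with the given generators and relations. -/
noncomputable abbrev operad : Operad C where
  Op := M.Operations
  src x := x.out.src
  tgt x := x.out.tgt
  one a := Operations.mk (.one a) (.one a)
  comp g fs h := Operations.mk (.comp g.out (fs.map Operations.out)) (.comp_self g.rel_out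
    (by
      intro s hs
      obtain ⟨x, _, rfl⟩ := List.mem_map.1 hs
      exact x.rel_out) (by simpa [Function.comp_def] using h))
  src_one a := (Operations.out_mk (.one a)).src_eq
  tgt_one a := (Operations.out_mk (.one a)).tgt_eq
  src_comp g fs h := by
    rw [(Operations.out_mk _).src_eq, Term.src_comp, List.flatMap_map]
  tgt_comp g fs h := (Operations.out_mk _).tgt_eq
  one_comp f := by
    apply Operations.eq_of_rel
    refine (Operations.out_mk _).trans (Rel.trans ?_ (Rel.one_comp f.rel_out))
    exact Rel.comp [(f.out, f.out)] (Operations.out_mk (.one _)) (by simpa using f.rel_out)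
      (Operations.out_mk (.one _)).src_eq.symm
  comp_one f := by
    apply Operations.eq_of_rel
    refine (Operations.out_mk _).trans (Rel.trans ?_ (Rel.comp_one f.rel_out))
    have := Rel.comp (M := M) (f.out.src.map fun a => ((Operations.mk (.one a) (.one a)).out, .one a)) f.rel_out
      (by
        intro p hp
        obtain ⟨a, _, rfl⟩ := List.mem_map.1 hp
        exact Operations.out_mk (.one a))
      (by
        rw [List.map_map]
        refine Eq.trans (List.map_congr_left fun a _ => (Operations.out_mk (.one a)).tgt_eq) ?_
        simp [Term.tgt])
    simpa [Function.comp_def] using this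
  assoc g L h := by
    have hL : ∀ p ∈ L, Rel M (Term.comp p.1.out (p.2.1.map Operations.out))
        (Term.comp p.1.out (p.2.1.map Operations.out)) := fun p _ => .comp_self p.1.rel_out
      (by
        intro s hs
        obtain ⟨x, _, rfl⟩ := List.mem_map.1 hs
        exact x.rel_out) (by simpa [Function.comp_def] using p.2.2)
    have hg : L.map (fun p => p.1.out.tgt) = g.out.src := by
      simpa [Function.comp_def] using h
    apply Operations.eq_of_rel
    refine (Operations.out_mk _).trans (Rel.trans ?_ (Rel.trans (Rel.assoc
      (L.map fun p => (p.1.out, p.2.1.map Operations.out)) g.rel_out ?_ ?_ ?_ ?_)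
      (Rel.trans ?_ (Operations.out_mk _).symm)))
    · have := Rel.comp (M := M)
        (L.attach.map fun p => ((Operations.mk (Term.comp p.1.1.out (p.1.2.1.map Operations.out)) (hL p.1 p.2)).out,
          Term.comp p.1.1.out (p.1.2.1.map Operations.out))) g.rel_out
        (by
          intro q hq
          obtain ⟨p, _, rfl⟩ := List.mem_map.1 hq
          exact Operations.out_mk _)
        (by
          rw [List.map_map, ← hg]
          conv_rhs => rw [← List.attach_map_subtype_val L, List.map_map]
          exact List.map_congr_left fun p _ => (Operations.out_mk (hL p.1 p.2)).tgt_eq)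
      convert this using 2
      · rw [List.map_map, List.map_map]
        conv_lhs => rw [← List.attach_map_subtype_val L, List.map_map]
        rfl
      · rw [List.map_map, List.map_map]
        conv_lhs => rw [← List.attach_map_subtype_val L, List.map_map]
        rfl
    · intro q hq
      obtain ⟨p, _, rfl⟩ := List.mem_map.1 hq
      exact p.1.rel_out
    · intro q hq s hs
      obtain ⟨p, _, rfl⟩ := List.mem_map.1 hq
      obtain ⟨x, _, rfl⟩ := List.mem_map.1 hs
      exact x.rel_out
    · intro q hq
      obtain ⟨p, _, rfl⟩ := List.mem_map.1 hq
      simpa [Function.comp_def] using p.2.2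
    · rw [List.map_map]; exact hg
    · have hc : Rel M (Term.comp g.out (L.map fun p => p.1.out))
          (Term.comp g.out (L.map fun p => p.1.out)) := .comp_self g.rel_out
        (by
          intro s hs
          obtain ⟨x, _, rfl⟩ := List.mem_map.1 hs
          exact x.1.rel_out) (by rw [List.map_map]; exact hg)
      have := Rel.comp (M := M)
        (L.flatMap fun p => p.2.1.map fun x => (x.out, x.out)) (t := Term.comp g.out (L.map fun p => p.1.out))
        (t' := (Operations.mk (Term.comp g.out ((L.map fun p => p.1).map Operations.out))
          (by simpa [Function.comp_def] using hc)).out)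
        (Rel.symm (Rel.trans (Operations.out_mk _) (by simpa [Function.comp_def] using hc)))
        (by
          intro q hq
          obtain ⟨p, _, hq⟩ := List.mem_flatMap.1 hq
          obtain ⟨x, _, rfl⟩ := List.mem_map.1 hq
          exact x.rel_out)
        (by
          rw [Term.src_comp, List.flatMap_map, List.map_flatMap]
          refine List.flatMap_congr fun p _ => ?_
          simpa [Function.comp_def] using p.2.2)
      convert this using 2
      · rw [List.map_map]; rfl
      · rw [List.map_flatMap, List.flatMap_map]; simp [Function.comp_def]
      · rw [List.map_flatMap, List.map_flatMap]; simp [Function.comp_def]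

/-- The operation given by a generator. -/
noncomputable def ofGen (g : M.Gen) : M.operad.Op := Operations.mk (.gen g) (.gen g)

theorem src_ofGen (g : M.Gen) : M.operad.src (M.ofGen g) = M.src g :=
  (Operations.out_mk (.gen g)).src_eq

theorem tgt_ofGen (g : M.Gen) : M.operad.tgt (M.ofGen g) = M.tgt g :=
  (Operations.out_mk (.gen g)).tgt_eq

theorem ofGen_of_isUnit {g : M.Gen} {a : C} (h : M.IsUnit g a) : M.ofGen g = M.operad.one a :=
  Operations.mk_eq (.unit h)

section Comp

variable {M}

/-- Composites in the presented operad are represented by formal composites. -/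
theorem comp_mk {t : Term M} (ht : Rel M t t) (ts : List (Term M)) (hts : ∀ s ∈ ts, Rel M s s)
    (h : ts.map Term.tgt = t.src)
    (h' : (ts.attach.map fun s => Operations.mk s.1 (hts s.1 s.2)).map M.operad.tgt =
      M.operad.src (Operations.mk t ht)) :
    M.operad.comp (Operations.mk t ht)
        (ts.attach.map fun s => Operations.mk s.1 (hts s.1 s.2)) h' =
      Operations.mk (.comp t ts) (.comp_self ht hts h) := by
  have := Rel.comp (M := M)
    (ts.attach.map fun s => (s.1, (Operations.mk s.1 (hts s.1 s.2)).out))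
    (Operations.out_mk ht).symm
    (by
      intro q hq
      obtain ⟨p, _, rfl⟩ := List.mem_map.1 hq
      exact (Operations.out_mk _).symm)
    (by
      rw [List.map_map]
      refine Eq.trans ?_ h
      conv_rhs => rw [← List.attach_map_subtype_val ts, List.map_map]
      rfl)
  apply Eq.symm
  apply Operations.eq_of_rel
  refine (Operations.out_mk _).trans (Rel.trans ?_ (Operations.out_mk _).symm)
  convert this using 2
  · rw [List.map_map]
    exact (List.attach_map_subtype_val ts).symm
  · simp [Function.comp_def]

theorem comp_ofGen {g : M.Gen} {fs : List M.Gen} {h : M.Gen} (H : M.IsComp g fs h)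
    (h' : (fs.map M.ofGen).map M.operad.tgt = M.operad.src (M.ofGen g)) :
    M.operad.comp (M.ofGen g) (fs.map M.ofGen) h' = M.ofGen h := by
  have h1 : ∀ s ∈ fs.map Term.gen, Rel M s s := by
    intro s hs
    obtain ⟨f, _, rfl⟩ := List.mem_map.1 hs
    exact .gen f
  have h2 : ((fs.map Term.gen).attach.map fun s => Operations.mk s.1 (h1 s.1 s.2)) =
      fs.map M.ofGen := by
    rw [List.attach_map, List.map_map]
    conv_rhs => rw [← List.attach_map_subtype_val fs, List.map_map]
    rfl
  have := comp_mk (M := M) (.gen g) (fs.map .gen) h1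
    (by rw [List.map_map]; exact M.map_tgt_of_isComp H) (by rw [h2]; exact h')
  refine ((M.operad.comp_congr rfl h2.symm _ _).trans this).trans (Operations.mk_eq (.composite H))

end Comp

section Lift

variable {M} {D : Type v} (Q : Operad D) (φ : C → D) (F : M.Gen → Q.Op)

open Classical in
mutual
/-- The value of a formal composite in an operad, given values of the generators. -/
noncomputable def eval : Term M → Q.Op
  | .one a => Q.one (φ a)
  | .gen g => F g
  | .comp t ts =>
    if h : (evals ts).map Q.tgt = Q.src (eval t) then Q.comp (eval t) (evals ts) h else eval t
/-- The values of a list of formal composites. -/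
noncomputable def evals : List (Term M) → List Q.Op
  | [] => []
  | t :: ts => eval t :: evals ts
end

theorem evals_eq (ts : List (Term M)) : evals Q φ F ts = ts.map (eval Q φ F) := by
  induction ts with
  | nil => rfl
  | cons t ts ih => simp [evals, ih]

theorem eval_comp (t : Term M) (ts : List (Term M))
    (h : (ts.map (eval Q φ F)).map Q.tgt = Q.src (eval Q φ F t)) :
    eval Q φ F (.comp t ts) = Q.comp (eval Q φ F t) (ts.map (eval Q φ F)) h := by
  rw [eval, dif_pos (by rw [evals_eq]; exact h)]
  exact Q.comp_congr rfl (evals_eq Q φ F ts) _ _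

theorem eval_rel
    (hsrc : ∀ g, Q.src (F g) = (M.src g).map φ) (htgt : ∀ g, Q.tgt (F g) = φ (M.tgt g))
    (hunit : ∀ g a, M.IsUnit g a → F g = Q.one (φ a))
    (hcomp : ∀ g fs h, M.IsComp g fs h → ∀ h', Q.comp (F g) (fs.map F) h' = F h)
    {t t' : Term M} (h : Rel M t t') :
    eval Q φ F t = eval Q φ F t' ∧ Q.src (eval Q φ F t) = t.src.map φ ∧
      Q.tgt (eval Q φ F t) = φ t.tgt := by
  induction h with
  | one a => exact ⟨rfl, by simp [eval, Q.src_one, Term.src], by simp [eval, Q.tgt_one, Term.tgt]⟩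
  | gen g => exact ⟨rfl, by rw [eval, hsrc]; rfl, by rw [eval, htgt]; rfl⟩
  | @comp t t' L h hL e ih ihL =>
    have h1 : ((L.map fun p => p.1).map (eval Q φ F)).map Q.tgt = Q.src (eval Q φ F t) := by
      rw [ih.2.1, ← e, List.map_map, List.map_map, List.map_map]
      exact List.map_congr_left fun p hp => (ihL p hp).2.2
    have h2 : (L.map fun p => p.1).map (eval Q φ F) = (L.map fun p => p.2).map (eval Q φ F) := by
      rw [List.map_map, List.map_map]
      exact List.map_congr_left fun p hp => (ihL p hp).1
    rw [eval_comp _ _ _ _ _ h1]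
    refine ⟨?_, ?_, ?_⟩
    · rw [eval_comp _ _ _ _ _ (by rw [← h2, ← ih.1]; exact h1)]
      exact Q.comp_congr ih.1 h2 _ _
    · rw [Q.src_comp, Term.src_comp, List.map_flatMap, List.flatMap_map, List.flatMap_map,
        List.flatMap_map]
      exact List.flatMap_congr fun p hp => (ihL p hp).2.1
    · rw [Q.tgt_comp]; exact ih.2.2
  | symm h ih =>
    exact ⟨ih.1.symm, by rw [← ih.1, ih.2.1, h.src_eq], by rw [← ih.1, ih.2.2, h.tgt_eq]⟩
  | trans h h' ih ih' => exact ⟨ih.1.trans ih'.1, ih.2⟩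
  | @one_comp t h ih =>
    have h1 : ([t].map (eval Q φ F)).map Q.tgt = Q.src (eval Q φ F (.one t.tgt)) := by
      simp [eval, Q.src_one, ih.2.2]
    have h2 : eval Q φ F (.comp (.one t.tgt) [t]) = eval Q φ F t := by
      rw [eval_comp _ _ _ _ _ h1]
      exact (Q.comp_congr (by rw [eval, ih.2.2]) rfl _ _).trans (Q.one_comp _)
    rw [h2]
    exact ⟨rfl, by rw [ih.2.1]; simp [Term.src_comp], ih.2.2⟩
  | @comp_one t h ih =>
    have h0 : (t.src.map Term.one).map (eval Q φ F) = (Q.src (eval Q φ F t)).map Q.one := by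
      rw [ih.2.1, List.map_map, List.map_map]; rfl
    have h1 : ((t.src.map Term.one).map (eval Q φ F)).map Q.tgt = Q.src (eval Q φ F t) := by
      rw [h0]; simp [Function.comp_def, Q.tgt_one]
    have h2 : eval Q φ F (.comp t (t.src.map .one)) = eval Q φ F t := by
      rw [eval_comp _ _ _ _ _ h1]
      exact (Q.comp_congr rfl h0 _ _).trans (Q.comp_one _)
    rw [h2]
    exact ⟨rfl, by rw [ih.2.1, Term.src_comp, List.flatMap_map]; simp [Term.src], ih.2.2⟩
  | @assoc t L h hL hLs e e' ih ihL ihLs =>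
    have hc : ∀ p ∈ L, (p.2.map (eval Q φ F)).map Q.tgt = Q.src (eval Q φ F p.1) := by
      intro p hp
      rw [(ihL p hp).2.1, ← e p hp, List.map_map, List.map_map]
      exact List.map_congr_left fun s hs => (ihLs p hp s hs).2.2
    have h1 : ((L.map fun p => p.1).map (eval Q φ F)).map Q.tgt = Q.src (eval Q φ F t) := by
      rw [ih.2.1, ← e', List.map_map, List.map_map, List.map_map]
      exact List.map_congr_left fun p hp => (ihL p hp).2.2
    let L' : List (Σ' (f : Q.Op) (hs : List Q.Op), hs.map Q.tgt = Q.src f) :=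
      L.attach.map fun p => ⟨eval Q φ F p.1.1, p.1.2.map (eval Q φ F), hc p.1 p.2⟩
    have e1 : L'.map (fun p => p.1) = (L.map fun p => p.1).map (eval Q φ F) := by
      rw [List.map_map, List.map_map]
      conv_rhs => rw [← List.attach_map_subtype_val L, List.map_map]
      rfl
    have e2 : L'.flatMap (fun p => p.2.1) = (L.flatMap fun p => p.2).map (eval Q φ F) := by
      rw [List.flatMap_map, List.map_flatMap]
      conv_rhs => rw [← List.attach_map_subtype_val L, List.flatMap_map]
    have e3 : L'.map (fun p => Q.comp p.1 p.2.1 p.2.2) =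
        (L.map fun p => Term.comp p.1 p.2).map (eval Q φ F) := by
      rw [List.map_map, List.map_map]
      conv_rhs => rw [← List.attach_map_subtype_val L, List.map_map]
      exact List.map_congr_left fun p _ => (eval_comp _ _ _ _ _ (hc p.1 p.2)).symm
    have h2 : ((L.map fun p => Term.comp p.1 p.2).map (eval Q φ F)).map Q.tgt =
        Q.src (eval Q φ F t) := by
      rw [← h1, ← e1, ← e3]
      exact (List.map_map (l := L')).trans ((List.map_congr_left fun p _ => Q.tgt_comp _ _ _).trans
        (List.map_map (l := L')).symm)
    have h3 := eval_comp Q φ F t (L.map fun p => p.1) h1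
    have h4 : ((L.flatMap fun p => p.2).map (eval Q φ F)).map Q.tgt =
        Q.src (eval Q φ F (.comp t (L.map fun p => p.1))) := by
      rw [h3, Q.src_comp, ← e1, ← e2]
      refine (List.map_flatMap (l := L')).trans (Eq.trans ?_ (List.flatMap_map _ _ _).symm)
      exact congrArg (fun F => L'.flatMap F) (funext fun p => p.2.2)
    refine ⟨?_, ?_, ?_⟩
    · rw [eval_comp _ _ _ _ _ h2, eval_comp _ _ _ _ _ h4]
      refine (Q.comp_congr rfl e3.symm _ (by rw [e3]; exact h2)).trans
        ((Q.assoc _ L' (by rw [e1]; exact h1)).trans ?_)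
      exact Q.comp_congr ((Q.comp_congr rfl e1 _ _).trans h3.symm) e2 _ _
    · rw [eval_comp _ _ _ _ _ h2, Q.src_comp, ← e3, List.flatMap_map, Term.src_comp,
        List.flatMap_map, List.map_flatMap]
      conv_rhs => rw [← List.attach_map_subtype_val L, List.flatMap_map]
      rw [List.flatMap_map]
      refine List.flatMap_congr fun p _ => ?_
      rw [Q.src_comp, Term.src_comp, List.map_flatMap, List.flatMap_map]
      exact List.flatMap_congr fun s hs => (ihLs p.1 p.2 s hs).2.1
    · rw [eval_comp _ _ _ _ _ h2, Q.tgt_comp]; exact ih.2.2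
  | unit h =>
    have h1 := hunit _ _ h
    refine ⟨by rw [eval, eval, h1], ?_, ?_⟩
    · rw [eval, hsrc]; rfl
    · rw [eval, htgt]; rfl
  | @composite g fs h H =>
    have h0 : (fs.map Term.gen).map (eval Q φ F) = fs.map F := by
      rw [List.map_map]; exact List.map_congr_left fun f _ => by simp [eval]
    have h1 : (fs.map F).map Q.tgt = Q.src (F g) := by
      rw [hsrc, ← M.map_tgt_of_isComp H, List.map_map, List.map_map]
      exact List.map_congr_left fun f _ => htgt f
    have h2 : eval Q φ F (.comp (.gen g) (fs.map .gen)) = F h := by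
      rw [eval_comp _ _ _ _ _ (by rw [h0]; simpa [eval] using h1), ← hcomp g fs h H h1]
      exact Q.comp_congr (by rw [eval]) h0 _ _
    rw [h2]
    exact ⟨by rw [eval], by rw [hsrc, M.src_of_isComp H, Term.src_comp, List.flatMap_map]; rfl,
      by rw [htgt, M.tgt_of_isComp H]; rfl⟩

/-- The morphism out of the presented operad determined by the values of the generators. -/
noncomputable def lift
    (hsrc : ∀ g, Q.src (F g) = (M.src g).map φ) (htgt : ∀ g, Q.tgt (F g) = φ (M.tgt g))
    (hunit : ∀ g a, M.IsUnit g a → F g = Q.one (φ a))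
    (hcomp : ∀ g fs h, M.IsComp g fs h → ∀ h', Q.comp (F g) (fs.map F) h' = F h)
    : Operad.OverHom φ M.operad Q where
  toFun x := eval Q φ F x.out
  src_toFun x := (eval_rel Q φ F hsrc htgt hunit hcomp x.rel_out).2.1
  tgt_toFun x := (eval_rel Q φ F hsrc htgt hunit hcomp x.rel_out).2.2
  map_one a := by
    refine (eval_rel Q φ F hsrc htgt hunit hcomp (Operations.out_mk (.one a))).1.trans ?_
    rw [eval]
  map_comp g fs h := by
    have h1 : ((fs.map Operations.out).map (eval Q φ F)).map Q.tgt =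
        Q.src (eval Q φ F g.out) := by
      rw [(eval_rel Q φ F hsrc htgt hunit hcomp g.rel_out).2.1]
      change _ = (M.operad.src g).map φ
      rw [← h, List.map_map, List.map_map, List.map_map]
      exact List.map_congr_left fun f _ =>
        (eval_rel Q φ F hsrc htgt hunit hcomp f.rel_out).2.2
    refine (eval_rel Q φ F hsrc htgt hunit hcomp (Operations.out_mk _)).1.trans ?_
    rw [eval_comp _ _ _ _ _ h1]
    exact Q.comp_congr rfl (by rw [List.map_map]; rfl) _ _

theorem lift_ofGen
    (hsrc : ∀ g, Q.src (F g) = (M.src g).map φ) (htgt : ∀ g, Q.tgt (F g) = φ (M.tgt g))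
    (hunit : ∀ g a, M.IsUnit g a → F g = Q.one (φ a))
    (hcomp : ∀ g fs h, M.IsComp g fs h → ∀ h', Q.comp (F g) (fs.map F) h' = F h)
    (g : M.Gen) :
    (lift Q φ F hsrc htgt hunit hcomp).toFun (M.ofGen g) = F g := by
  have := (eval_rel Q φ F hsrc htgt hunit hcomp (Operations.out_mk (.gen g))).1
  exact this.trans (by rw [eval])

end Lift

theorem operad_induction {M : OperadPresentation C} {p : M.operad.Op → Prop}
    (one : ∀ a, p (M.operad.one a)) (gen : ∀ g, p (M.ofGen g))
    (comp : ∀ g fs h, p g → (∀ f ∈ fs, p f) → p (M.operad.comp g fs h)) (x : M.operad.Op) :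
    p x := by
  have key : ∀ t t' : Term M, Rel M t t' →
      (∀ h, p (Operations.mk t h)) ∧ (∀ h, p (Operations.mk t' h)) := by
    intro t t' h
    have transfer : ∀ {s s' : Term M}, Rel M s s' → (∀ h, p (Operations.mk s h)) →
        ∀ h, p (Operations.mk s' h) := by
      intro s s' hs hp h
      have := hp hs.left
      rwa [Operations.mk_eq hs] at this
    have hcomp : ∀ (t : Term M) (ts : List (Term M)), Rel M t t → (∀ s ∈ ts, Rel M s s) →
        ts.map Term.tgt = t.src → (∀ h, p (Operations.mk t h)) →
        (∀ s ∈ ts, ∀ h, p (Operations.mk s h)) → ∀ h, p (Operations.mk (.comp t ts) h) := by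
      intro t ts ht hts e hp hps h
      have h' : (ts.attach.map fun s => Operations.mk s.1 (hts s.1 s.2)).map M.operad.tgt =
          M.operad.src (Operations.mk t ht) := by
        have e1 : M.operad.src (Operations.mk t ht) = t.src := (Operations.out_mk ht).src_eq
        rw [e1, ← e, List.map_map]
        conv_rhs => rw [← List.attach_map_subtype_val ts, List.map_map]
        exact List.map_congr_left fun s _ => (Operations.out_mk _).tgt_eq
      rw [← comp_mk ht ts hts e h']
      refine comp _ _ _ (hp _) ?_
      intro f hf
      obtain ⟨s, _, rfl⟩ := List.mem_map.1 hf
      exact hps s.1 s.2 _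
    induction h with
    | one a => exact ⟨fun _ => one a, fun _ => one a⟩
    | gen g => exact ⟨fun _ => gen g, fun _ => gen g⟩
    | @comp t t' L h hL e ih ihL =>
      have h1 : ∀ h, p (Operations.mk (.comp t (L.map fun p => p.1)) h) := by
        refine hcomp t _ h.left ?_ (by rw [List.map_map]; exact e) ih.1 ?_
        · intro s hs
          obtain ⟨q, hq, rfl⟩ := List.mem_map.1 hs
          exact (hL q hq).left
        · intro s hs
          obtain ⟨q, hq, rfl⟩ := List.mem_map.1 hs
          exact (ihL q hq).1
      exact ⟨h1, transfer (.comp L h hL e) h1⟩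
    | symm _ ih => exact ⟨ih.2, ih.1⟩
    | trans _ _ ih ih' => exact ⟨ih.1, ih'.2⟩
    | one_comp h ih => exact ⟨transfer (Rel.one_comp h).symm ih.1, ih.1⟩
    | comp_one h ih => exact ⟨transfer (Rel.comp_one h).symm ih.1, ih.1⟩
    | @assoc t L h hL hLs e e' ih ihL ihLs =>
      have h1 : ∀ h, p (Operations.mk (.comp t (L.map fun p => .comp p.1 p.2)) h) := by
        refine hcomp t _ h ?_ (by rw [List.map_map]; exact e') ih.1 ?_
        · intro s hs
          obtain ⟨q, hq, rfl⟩ := List.mem_map.1 hs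
          exact .comp_self (hL q hq) (hLs q hq) (e q hq)
        · intro s hs
          obtain ⟨q, hq, rfl⟩ := List.mem_map.1 hs
          exact hcomp _ _ (hL q hq) (hLs q hq) (e q hq) (ihL q hq).1
            fun s hs => (ihLs q hq s hs).1
      exact ⟨h1, transfer (.assoc L h hL hLs e e') h1⟩
    | @unit g a h => exact ⟨fun _ => gen g, fun _ => one a⟩
    | @composite g fs h H =>
      exact ⟨transfer (Rel.composite H).symm fun _ => gen h, fun _ => gen h⟩
  have := (key _ _ (Operations.rel_out x)).1 (Operations.rel_out x)
  rwa [Operations.mk_out] at this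

/-- Morphisms out of a presented operad that agree on the generators are equal. -/
theorem hom_ext {M : OperadPresentation C} {D : Type v} {Q : Operad D} {φ : C → D}
    {F G : Operad.OverHom φ M.operad Q}
    (h : ∀ g, F.toFun (M.ofGen g) = G.toFun (M.ofGen g)) : F = G := by
  ext x
  induction x using operad_induction with
  | one a => rw [F.map_one, G.map_one]
  | gen g => exact h g
  | comp g fs e ih ihs =>
    rw [F.map_comp, G.map_comp]
    exact Q.comp_congr ih (List.map_congr_left ihs) _ _

end OperadPresentation

/-- Simplicial lists: simplicial objects in the category of sets and listings (the Kleisli category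
of the list monad). -/
abbrev SimplicialList := SimplicialObject (KleisliCat.{u, u} List)

namespace SimplicialList

/-- The set of `k`-simplices. -/
def Simp (X : SimplicialList.{u}) (k : ℕ) : Type u := X.obj (op (SimplexCategory.mk k))

/-- The listing `θ^*` given by the action of `θ : [k] ⟶ [n]`. -/
def act (X : SimplicialList.{u}) {k n : ℕ} (θ : SimplexCategory.mk k ⟶ SimplexCategory.mk n)
    (x : X.Simp n) : List (X.Simp k) := X.map θ.op x

theorem act_id (X : SimplicialList.{u}) {n : ℕ} (x : X.Simp n) : X.act (𝟙 _) x = [x] := by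
  unfold act
  rw [op_id, X.map_id]
  rfl

theorem act_comp (X : SimplicialList.{u}) {k l n : ℕ}
    (η : SimplexCategory.mk k ⟶ SimplexCategory.mk l)
    (θ : SimplexCategory.mk l ⟶ SimplexCategory.mk n) (x : X.Simp n) :
    X.act (η ≫ θ) x = (X.act θ x).flatMap (X.act η) := by
  unfold act
  rw [op_comp, X.map_comp]
  rfl

/-- A simplicial list is operadic if `θ^*` is a function whenever `θ` preserves the last
vertex. -/
def IsOperadic (X : SimplicialList.{u}) : Prop :=
  ∀ ⦃k n : ℕ⦄ (θ : SimplexCategory.mk k ⟶ SimplexCategory.mk n),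
    θ.toOrderHom (Fin.last k) = Fin.last n → ∀ x, ∃ y, X.act θ x = [y]

/-- The functional morphisms of simplicial lists. -/
structure FunctionalHom (X Y : SimplicialList.{u}) where
  toFun {k : ℕ} (x : X.Simp k) : Y.Simp k
  act_toFun {k n : ℕ} (θ : SimplexCategory.mk k ⟶ SimplexCategory.mk n) (x : X.Simp n) :
    Y.act θ (toFun x) = (X.act θ x).map toFun

section FreeOperad

variable {X : SimplicialList.{u}} (hX : X.IsOperadic)

/-- The last vertex of a `1`-simplex of an operadic simplicial list. -/
noncomputable def target (g : X.Simp 1) : X.Simp 0 :=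
  (hX (SimplexCategory.δ (0 : Fin 2)) (by decide) g).choose

theorem act_δ_zero (g : X.Simp 1) :
    X.act (SimplexCategory.δ (0 : Fin 2)) g = [target hX g] :=
  (hX (SimplexCategory.δ (0 : Fin 2)) (by decide) g).choose_spec

variable {C : Type u} (e : X.Simp 0 ≃ C)

/-- The presentation of the free operad on an operadic simplicial list `X`, whose vertices are
identified with a set `C` of colours by a bijection `e`. The generators are the `1`-simplices `g`,
with inputs `d₁ g` and output `d₀ g`. The degeneracy of a vertex is an identity, and every
`2`-simplex `σ` gives a relation `d₁ σ = d₀ σ ∘ d₂ σ`. -/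
noncomputable abbrev presentation : OperadPresentation C where
  Gen := X.Simp 1
  src g := (X.act (SimplexCategory.δ (1 : Fin 2)) g).map e
  tgt g := e (target hX g)
  IsUnit g a := ∃ x : X.Simp 0, X.act (SimplexCategory.σ (0 : Fin 1)) x = [g] ∧ e x = a
  IsComp g fs h := ∃ σ : X.Simp 2, X.act (SimplexCategory.δ (0 : Fin 3)) σ = [g] ∧
    X.act (SimplexCategory.δ (2 : Fin 3)) σ = fs ∧ X.act (SimplexCategory.δ (1 : Fin 3)) σ = [h]
  src_of_isUnit := by
    rintro g a ⟨x, hx, rfl⟩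
    have h := X.act_comp (SimplexCategory.δ (1 : Fin 2)) (SimplexCategory.σ (0 : Fin 1)) x
    rw [hx, List.flatMap_singleton] at h
    rw [← h, ← List.map_singleton (f := e), ← X.act_id x]
    exact congrArg (fun θ => (X.act θ x).map e) SimplexCategory.δ_comp_σ_succ
  tgt_of_isUnit := by
    rintro g a ⟨x, hx, rfl⟩
    have h := X.act_comp (SimplexCategory.δ (0 : Fin 2)) (SimplexCategory.σ (0 : Fin 1)) x
    rw [hx, List.flatMap_singleton, act_δ_zero hX] at h
    have h' := (congrArg (fun θ => X.act θ x) (SimplexCategory.δ_comp_σ_self (i := 0))).symm.trans h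
    rw [act_id, List.singleton_inj] at h'
    rw [h']
  map_tgt_of_isComp := by
    rintro g fs h ⟨σ, h0, h2, h1⟩
    have e1 := X.act_comp (SimplexCategory.δ (0 : Fin 2)) (SimplexCategory.δ (2 : Fin 3)) σ
    have e2 := X.act_comp (SimplexCategory.δ (1 : Fin 2)) (SimplexCategory.δ (0 : Fin 3)) σ
    have e3 := SimplexCategory.δ_comp_δ (i := (0 : Fin 2)) (j := 1) (by decide)
    rw [h2] at e1
    rw [h0, List.flatMap_singleton] at e2
    have e4 := e1.symm.trans ((congrArg (fun θ => X.act θ σ) e3).trans e2)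
    rw [← e4, List.map_flatMap]
    rw [← List.flatMap_singleton' (fs.map _), List.flatMap_map]
    exact List.flatMap_congr fun f _ => by rw [act_δ_zero hX]; rfl
  src_of_isComp := by
    rintro g fs h ⟨σ, h0, h2, h1⟩
    have e1 := X.act_comp (SimplexCategory.δ (1 : Fin 2)) (SimplexCategory.δ (2 : Fin 3)) σ
    have e2 := X.act_comp (SimplexCategory.δ (1 : Fin 2)) (SimplexCategory.δ (1 : Fin 3)) σ
    have e3 := SimplexCategory.δ_comp_δ (i := (1 : Fin 2)) (j := 1) (by decide)
    rw [h2] at e1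
    rw [h1, List.flatMap_singleton] at e2
    have e4 := e1.symm.trans ((congrArg (fun θ => X.act θ σ) e3).trans e2)
    rw [← e4, List.map_flatMap]
  tgt_of_isComp := by
    rintro g fs h ⟨σ, h0, h2, h1⟩
    have e1 := X.act_comp (SimplexCategory.δ (0 : Fin 2)) (SimplexCategory.δ (1 : Fin 3)) σ
    have e2 := X.act_comp (SimplexCategory.δ (0 : Fin 2)) (SimplexCategory.δ (0 : Fin 3)) σ
    have e3 := SimplexCategory.δ_comp_δ (i := (0 : Fin 2)) (j := 0) (by decide)
    rw [h1, List.flatMap_singleton, act_δ_zero hX] at e1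
    rw [h0, List.flatMap_singleton, act_δ_zero hX] at e2
    have e4 := e1.symm.trans ((congrArg (fun θ => X.act θ σ) e3).trans e2)
    rw [List.singleton_inj] at e4
    rw [e4]

/-- The free operad `τ₁ X` on an operadic simplicial list `X`. -/
noncomputable abbrev freeOperad : Operad C := (presentation hX e).operad

end FreeOperad

section Map

variable {X Y : SimplicialList.{u}} (hX : X.IsOperadic) (hY : Y.IsOperadic) {C : Type u}
  (eX : X.Simp 0 ≃ C) (eY : Y.Simp 0 ≃ C) (f : FunctionalHom X Y)
  (hf : ∀ x : X.Simp 0, eY (f.toFun x) = eX x)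

theorem target_toFun (hX : X.IsOperadic) (hY : Y.IsOperadic) (f : FunctionalHom X Y)
    (g : X.Simp 1) : target hY (f.toFun g) = f.toFun (target hX g) := by
  have h := f.act_toFun (SimplexCategory.δ (0 : Fin 2)) g
  rw [act_δ_zero hX, act_δ_zero hY] at h
  simpa using h

/-- The action of `τ₁` on functional morphisms that are compatible with the identifications of the
vertices with `C`. -/
noncomputable def freeOperadMap : freeOperad hX eX ⟶ freeOperad hY eY :=
  OperadPresentation.lift (freeOperad hY eY) id
    (fun g => (presentation hY eY).ofGen (f.toFun g))
    (by
      intro g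
      refine ((presentation hY eY).src_ofGen _).trans ?_
      change (Y.act _ (f.toFun g)).map eY = ((X.act _ g).map eX).map id
      rw [f.act_toFun, List.map_map, List.map_id]
      exact List.map_congr_left fun x _ => hf x)
    (by
      intro g
      refine ((presentation hY eY).tgt_ofGen _).trans ?_
      change eY (target hY (f.toFun g)) = eX (target hX g)
      rw [target_toFun hX hY, hf])
    (by
      rintro g a ⟨x, hx, rfl⟩
      refine OperadPresentation.ofGen_of_isUnit (presentation hY eY) ⟨f.toFun x, ?_, hf x⟩
      rw [f.act_toFun, hx]; rfl)
    (by
      rintro g fs h ⟨σ, h0, h2, h1⟩ h'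
      refine (Operad.comp_congr _ rfl ?_ _ ?_).trans (OperadPresentation.comp_ofGen
        (M := presentation hY eY) (g := f.toFun g) (fs := fs.map f.toFun) (h := f.toFun h) ⟨f.toFun σ, ?_, ?_, ?_⟩ ?_)
      · rw [List.map_map]; rfl
      · exact (congrArg _ List.map_map).trans h'
      · rw [f.act_toFun, h0]; rfl
      · rw [f.act_toFun, h2]
      · rw [f.act_toFun, h1]; rfl
      · exact (congrArg _ List.map_map).trans h')

theorem freeOperadMap_ofGen (g : X.Simp 1) :
    (freeOperadMap hX hY eX eY f hf).toFun ((presentation hX eX).ofGen g) =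
      (presentation hY eY).ofGen (f.toFun g) :=
  OperadPresentation.lift_ofGen (M := presentation hX eX) _ _ _ _ _ _ _ g

end Map

end SimplicialList

namespace AugmentedSimplexCategory

/-- The underlying finite ordinal `{0, …, k - 1}` of an object of `Δ₊` has `size` elements. -/
def size : AugmentedSimplexCategory → ℕ
  | .of x => x.len + 1
  | .star => 0

/-- The monotone map underlying a morphism of `Δ₊`. -/
def ordMap : {x y : AugmentedSimplexCategory} → (x ⟶ y) → (Fin (size x) →o Fin (size y))
  | .of _, .of _, f => SimplexCategory.Hom.toOrderHom (WithInitial.down f)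
  | .star, _, _ => ⟨Fin.elim0, fun a => a.elim0⟩
  | .of _, .star, f => (WithInitial.false_of_to_star f).elim

theorem ordMap_id (x : AugmentedSimplexCategory) : ordMap (𝟙 x) = OrderHom.id := by
  cases x with
  | of x => rfl
  | star => ext a; exact a.elim0

theorem ordMap_comp {x y z : AugmentedSimplexCategory} (f : x ⟶ y) (g : y ⟶ z) :
    ordMap (f ≫ g) = (ordMap g).comp (ordMap f) := by
  cases x with
  | star => ext a; exact a.elim0
  | of x =>
    cases y with
    | star => exact (WithInitial.false_of_to_star f).elim
    | of y =>
      cases z with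
      | star => exact (WithInitial.false_of_to_star g).elim
      | of z => rfl

/-- The fibre of a map over `a`, as a sequence in increasing order. -/
def fiber {p q : ℕ} (f : Fin p → Fin q) (a : Fin q) : List (Fin p) :=
  (List.finRange p).filter fun b => f b = a

theorem mem_fiber {p q : ℕ} {f : Fin p → Fin q} {a : Fin q} {b : Fin p} :
    b ∈ fiber f a ↔ f b = a := by simp [fiber]

theorem fiber_pairwise {p q : ℕ} (f : Fin p → Fin q) (a : Fin q) :
    (fiber f a).Pairwise (· < ·) :=
  List.Pairwise.filter _ (List.pairwise_lt_finRange p)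

theorem eq_of_mem_iff_of_pairwise {p : ℕ} {l l' : List (Fin p)} (hl : l.Pairwise (· < ·))
    (hl' : l'.Pairwise (· < ·)) (h : ∀ a, a ∈ l ↔ a ∈ l') : l = l' := by
  have hp : l.Perm l' := (List.perm_ext_iff_of_nodup (hl.imp ne_of_lt) (hl'.imp ne_of_lt)).2 h
  exact hp.eq_of_pairwise' (r := (· < ·)) hl hl'

theorem fiber_id {p : ℕ} (a : Fin p) : fiber (fun b => b) a = [a] :=
  eq_of_mem_iff_of_pairwise (fiber_pairwise _ _) (List.pairwise_singleton _ _)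
    (by simp [mem_fiber])

theorem fiber_flatMap {p q r : ℕ} (f : Fin p →o Fin q) (g : Fin q → Fin r) (c : Fin r) :
    (fiber g c).flatMap (fiber f) = fiber (fun b => g (f b)) c := by
  refine eq_of_mem_iff_of_pairwise ?_ (fiber_pairwise _ _) (by simp [mem_fiber])
  rw [List.pairwise_flatMap]
  refine ⟨fun a _ => fiber_pairwise _ _, (fiber_pairwise g c).imp ?_⟩
  intro b b' hb x hx y hy
  rw [mem_fiber] at hx hy
  by_contra! hxy
  have := f.monotone hxy
  rw [hx, hy] at this
  exact absurd hb (not_lt.2 this)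

end AugmentedSimplexCategory

/-- The objects of the category of `m`-simplices of the simplicial thickening of `[n]`. -/
structure ThickLevel (n : ℕ) (m : SimplexCategoryᵒᵖ) where
  as : Fin (n + 1)

namespace ThickLevel

variable {n : ℕ}

instance (i j : SimplicialThickening (Fin (n + 1))) : Quiver.IsThin (i ⟶ j) :=
  fun _ _ => ⟨fun _ _ => InducedCategory.Hom.ext (Subsingleton.elim _ _)⟩

/-- A morphism `i ⟶ j` is an `m`-simplex of the mapping space of the simplicial thickening: a chain
`U₀ ⊆ ⋯ ⊆ Uₘ` of subsets of `{i, …, j}` that contain `i` and `j`. Composition is by unions. -/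
instance (m : SimplexCategoryᵒᵖ) : Category (ThickLevel n m) where
  Hom i j := (nerve (SimplicialThickening.mk i.as ⟶ SimplicialThickening.mk j.as)).obj m
  id i := (Functor.const _).obj (𝟙 (SimplicialThickening.mk i.as))
  comp f g := f.prod' g ⋙ SimplicialThickening.compFunctor _ _ _
  id_comp f := nerve.ext_of_isThin (funext fun x => Category.id_comp (Functor.obj f x))
  comp_id f := nerve.ext_of_isThin (funext fun x => Category.comp_id (Functor.obj f x))
  assoc f g h := nerve.ext_of_isThin (funext fun x =>
    Category.assoc (Functor.obj f x) (Functor.obj g x) (Functor.obj h x))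

/-- The projection from the simplicial thickening of `[n]` to `[n]`. -/
def proj (n : ℕ) (m : SimplexCategoryᵒᵖ) : ThickLevel n m ⥤ Fin (n + 1) where
  obj i := i.as
  map f := homOfLE (SimplicialThickening.Path.le (Functor.obj f 0))

/-- The simplicial operators of the simplicial thickening. -/
def operator (n : ℕ) {m m' : SimplexCategoryᵒᵖ} (μ : m ⟶ m') : ThickLevel n m ⥤ ThickLevel n m' where
  obj i := ⟨i.as⟩
  map f := (nerve _).map μ f

end ThickLevel

open AugmentedSimplexCategory

namespace LeveledTree

variable {n : ℕ} (α : ComposableArrows AugmentedSimplexCategory n)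

/-- The elements of the finite ordinal `A_i`, for an `n`-simplex `α = (A_0 ⟶ ⋯ ⟶ A_n)` of
`N(Δ₊)`. -/
abbrev Vertex (i : Fin (n + 1)) : Type := Fin (size (α.obj i))

/-- The set of colours `A_0 ⊔ ⋯ ⊔ A_n`. -/
abbrev Colour : Type := Σ i : Fin (n + 1), Vertex α i

/-- The sequence `α_{i,j}⁻¹(a)` of elements of `A_i`, in increasing order. -/
def preimage {i j : Fin (n + 1)} (f : i ⟶ j) (a : Vertex α j) : List (Vertex α i) :=
  fiber (ordMap (α.map f)) a

theorem preimage_id {i : Fin (n + 1)} (f : i ⟶ i) (a : Vertex α i) : preimage α f a = [a] := by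
  rw [Subsingleton.elim f (𝟙 i), preimage, α.map_id, ordMap_id]
  exact fiber_id a

theorem preimage_eq_singleton {i j : Fin (n + 1)} (h : i = j) (f : i ⟶ j) (a : Vertex α j) :
    ∃ b, preimage α f a = [b] := by
  subst h
  exact ⟨a, preimage_id α f a⟩

theorem preimage_flatMap {i j k : Fin (n + 1)} (f : i ⟶ j) (g : j ⟶ k) (h : i ⟶ k)
    (a : Vertex α k) : (preimage α g a).flatMap (preimage α f) = preimage α h a := by
  rw [Subsingleton.elim h (f ≫ g), preimage, preimage, α.map_comp, ordMap_comp]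
  exact fiber_flatMap (ordMap (α.map f)) (ordMap (α.map g)) a

/-- The thick simplicial list `𝕌_α^{(m)}`. Its `k`-simplices are the pairs `(θ, a)` of a functor
`θ` from `[k]` to the category of `m`-simplices of the simplicial thickening of `[n]` and an element
`a ∈ A_{θ(k)}`. For `η : [l] ⟶ [k]`, the sequence `η^*(θ, a)` consists of the pairs `(θη, b)`
with `b ∈ A_{θη(l)}` mapped to `a`. -/
def thickList (m : SimplexCategoryᵒᵖ) : SimplicialList.{0} where
  obj k := Σ θ : (nerve (ThickLevel n m)).obj k,
    Vertex α ((ThickLevel.proj n m).obj (θ.obj (Fin.last k.unop.len)))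
  map {k l} η x :=
    (preimage α ((ThickLevel.proj n m).map (x.1.map (homOfLE (Fin.le_last
      (η.unop.toOrderHom (Fin.last l.unop.len)))))) x.2).map
      fun b => ⟨(nerve (ThickLevel n m)).map η x.1, b⟩
  map_id k := by
    funext x
    exact (congrArg _ (preimage_id α _ x.2)).trans rfl
  map_comp {k l j} η η' := by
    funext x
    refine Eq.trans ?_ (KleisliCat.comp_def _ _ _ _ _ _).symm
    refine Eq.trans ?_ (List.flatMap_map ..).symm
    refine (congrArg (List.map _) (preimage_flatMap α ((ThickLevel.proj n m).map
      (CategoryTheory.Functor.map ((nerve (ThickLevel n m)).map η x.1) (homOfLE (Fin.le_last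
        (η'.unop.toOrderHom (Fin.last j.unop.len))))))
      ((ThickLevel.proj n m).map (x.1.map (homOfLE (Fin.le_last
        (η.unop.toOrderHom (Fin.last l.unop.len)))))) _ x.2).symm).trans ?_
    exact List.map_flatMap.trans rfl

theorem thickList_isOperadic (m : SimplexCategoryᵒᵖ) : (thickList α m).IsOperadic := by
  rintro k l θ hθ ⟨x, a⟩
  obtain ⟨b, hb⟩ := preimage_eq_singleton α (congrArg (fun i => (x.obj i).as) hθ)
    ((ThickLevel.proj n m).map (x.map (homOfLE (Fin.le_last (θ.toOrderHom (Fin.last k)))))) a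
  exact ⟨_, congrArg (List.map _) hb⟩

/-- The vertices of `𝕌_α^{(m)}` are the elements of `A_0 ⊔ ⋯ ⊔ A_n`. -/
def thickVertices (m : SimplexCategoryᵒᵖ) : (thickList α m).Simp 0 ≃ Colour α where
  toFun x := ⟨(x.1.obj 0).as, x.2⟩
  invFun c := ⟨ComposableArrows.mk₀ ⟨c.1⟩, c.2⟩
  left_inv := by
    rintro ⟨x, a⟩
    obtain ⟨i, rfl⟩ := ComposableArrows.mk₀_surjective x
    rfl
  right_inv c := rfl

/-- The (functional) simplicial operators of `𝕌_α` in the variable `m`. -/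
def thickOperator {m m' : SimplexCategoryᵒᵖ} (μ : m ⟶ m') :
    SimplicialList.FunctionalHom (thickList α m) (thickList α m') where
  toFun x := ⟨(nerveMap (ThickLevel.operator n μ)).app _ x.1, x.2⟩
  act_toFun θ x := by
    refine Eq.trans ?_ List.map_map.symm
    rfl

/-- The presentation of the operad `τ₁ 𝕌_α^{(m)}`. -/
noncomputable abbrev thickPresentation (m : SimplexCategoryᵒᵖ) : OperadPresentation (Colour α) :=
  SimplicialList.presentation (thickList_isOperadic α m) (thickVertices α m)

/-- The morphism `τ₁ 𝕌_α^{(m)} ⟶ τ₁ 𝕌_α^{(m')}` given by a simplicial operator in the variable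
`m`. -/
noncomputable def thickMap {m m' : SimplexCategoryᵒᵖ} (μ : m ⟶ m') :
    (thickPresentation α m).operad ⟶ (thickPresentation α m').operad :=
  SimplicialList.freeOperadMap (thickList_isOperadic α m) (thickList_isOperadic α m')
    (thickVertices α m) (thickVertices α m') (thickOperator α μ) (fun _ => rfl)

theorem thickMap_ofGen {m m' : SimplexCategoryᵒᵖ} (μ : m ⟶ m') (g : (thickList α m).Simp 1) :
    Operad.OverHom.toFun (thickMap α μ) ((thickPresentation α m).ofGen g) =
      (thickPresentation α m').ofGen ((thickOperator α μ).toFun g) :=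
  SimplicialList.freeOperadMap_ofGen ..

/-- The simplicial operad `V_α = τ₁ 𝕌_α`, obtained by applying `τ₁` in every simplicial degree. -/
noncomputable def V : SimplicialOperad.{0} where
  Col := Colour α
  level :=
    { obj := fun m => (thickPresentation α m).operad
      map := fun μ => thickMap α μ
      map_id := fun m => OperadPresentation.hom_ext fun g => thickMap_ofGen α (𝟙 m) g
      map_comp := fun μ μ' => OperadPresentation.hom_ext fun g =>
        (thickMap_ofGen α (μ ≫ μ') g).trans (((congrArg (Operad.OverHom.toFun (thickMap α μ'))
          (thickMap_ofGen α μ g)).trans (thickMap_ofGen α μ' _)).symm) }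

/-- The presentation of `T_α`: one generator `p_i^{(a)} : α_i⁻¹(a) ⟶ a` for every `1 ≤ i ≤ n` and
`a ∈ A_i`, and no relations. -/
abbrev treePresentation : OperadPresentation (Colour α) where
  Gen := Σ i : Fin n, Vertex α i.succ
  src g := (preimage α (homOfLE g.1.castSucc_lt_succ.le) g.2).map fun b => ⟨g.1.castSucc, b⟩
  tgt g := ⟨g.1.succ, g.2⟩
  IsUnit _ _ := False
  IsComp _ _ _ := False
  src_of_isUnit := False.elim
  tgt_of_isUnit := False.elim
  map_tgt_of_isComp := False.elim
  src_of_isComp := False.elim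
  tgt_of_isComp := False.elim

/-- The operad `T_α`, which is free on the generators `p_i^{(a)}`. -/
noncomputable abbrev T : Operad (Colour α) := (treePresentation α).operad

/-- The operation `p_{i,j}^{(a)} : α_{i,j}⁻¹(a) ⟶ a` of `T_α`, for `i ≤ j`: it is the identity for
`i = j`, and the composite of `p_{j+1}^{(a)}` with the operations `p_{i,j}^{(b)}`, `b ↦ a`, for
`i ≤ j`. -/
noncomputable def treeOpAux (i j : Fin (n + 1)) : (a : Vertex α j) →
    {f : (T α).Op // (T α).tgt f = ⟨j, a⟩ ∧
      ∀ h : i ⟶ j, (T α).src f = (preimage α h a).map fun b => ⟨i, b⟩} :=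
  Fin.induction (motive := fun j => (a : Vertex α j) →
    {f : (T α).Op // (T α).tgt f = ⟨j, a⟩ ∧
      ∀ h : i ⟶ j, (T α).src f = (preimage α h a).map fun b => ⟨i, b⟩})
    (fun a => ⟨(T α).one ⟨0, a⟩, (T α).tgt_one _, by
      intro h
      obtain rfl : i = 0 := le_antisymm (leOfHom h) (Fin.zero_le i)
      rw [preimage_id]
      exact (T α).src_one _⟩)
    (fun j p a =>
      if hij : i = j.succ then ⟨(T α).one ⟨j.succ, a⟩, (T α).tgt_one _, by
        intro h
        subst hij
        rw [preimage_id]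
        exact (T α).src_one _⟩
      else ⟨(T α).comp ((treePresentation α).ofGen ⟨j, a⟩)
          ((preimage α (homOfLE j.castSucc_lt_succ.le) a).map fun b => (p b).1)
          (by
            rw [OperadPresentation.src_ofGen, List.map_map]
            exact List.map_congr_left fun b _ => (p b).2.1),
        by rw [Operad.tgt_comp, OperadPresentation.tgt_ofGen],
        by
          intro h
          have hij' : i ≤ j.castSucc := Fin.le_castSucc_iff.2 (lt_of_le_of_ne (leOfHom h) hij)
          rw [Operad.src_comp, List.flatMap_map, ← preimage_flatMap α (homOfLE hij')
            (homOfLE j.castSucc_lt_succ.le) h a, List.map_flatMap]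
          exact List.flatMap_congr fun b _ => (p b).2.2 _⟩) j

/-- The operation `p_{i,j}^{(a)}` of `T_α`. -/
noncomputable def treeOp (i j : Fin (n + 1)) (a : Vertex α j) : (T α).Op := (treeOpAux α i j a).1

theorem tgt_treeOp (i j : Fin (n + 1)) (a : Vertex α j) : (T α).tgt (treeOp α i j a) = ⟨j, a⟩ :=
  (treeOpAux α i j a).2.1

theorem src_treeOp {i j : Fin (n + 1)} (h : i ⟶ j) (a : Vertex α j) :
    (T α).src (treeOp α i j a) = (preimage α h a).map fun b => ⟨i, b⟩ :=
  (treeOpAux α i j a).2.2 h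

theorem map_tgt_treeOp {i j k : Fin (n + 1)} (h : j ⟶ k) (a : Vertex α k) :
    ((preimage α h a).map (treeOp α i j)).map (T α).tgt = (T α).src (treeOp α j k a) := by
  rw [src_treeOp α h, List.map_map]
  exact List.map_congr_left fun b _ => tgt_treeOp α i j b

theorem treeOp_self (i : Fin (n + 1)) (a : Vertex α i) : treeOp α i i a = (T α).one ⟨i, a⟩ := by
  induction i using Fin.cases with
  | zero => rfl
  | succ i =>
    unfold treeOp treeOpAux
    rw [Fin.induction_succ, dif_pos rfl]

theorem map_tgt_treeOp_succ (i : Fin (n + 1)) (j : Fin n) (a : Vertex α j.succ) :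
    ((preimage α (homOfLE j.castSucc_lt_succ.le) a).map (treeOp α i j.castSucc)).map (T α).tgt =
      (T α).src ((treePresentation α).ofGen ⟨j, a⟩) := by
  rw [OperadPresentation.src_ofGen, List.map_map]
  exact List.map_congr_left fun b _ => tgt_treeOp α i _ b

theorem treeOp_succ {i : Fin (n + 1)} {j : Fin n} (h : i ≤ j.castSucc) (a : Vertex α j.succ) :
    treeOp α i j.succ a = (T α).comp ((treePresentation α).ofGen ⟨j, a⟩)
      ((preimage α (homOfLE j.castSucc_lt_succ.le) a).map (treeOp α i j.castSucc))
      (map_tgt_treeOp_succ α i j a) := by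
  unfold treeOp treeOpAux
  rw [Fin.induction_succ, dif_neg (ne_of_lt (lt_of_le_of_lt h j.castSucc_lt_succ))]

theorem treeOp_comp {i j k : Fin (n + 1)} (h : i ⟶ j) (h' : j ⟶ k) (a : Vertex α k) :
    (T α).comp (treeOp α j k a) ((preimage α h' a).map (treeOp α i j)) (map_tgt_treeOp α h' a) =
      treeOp α i k a := by
  have refl_case : ∀ (h' : j ⟶ j) (a : Vertex α j), (T α).comp (treeOp α j j a)
      ((preimage α h' a).map (treeOp α i j)) (map_tgt_treeOp α h' a) = treeOp α i j a := by
    intro h' a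
    refine (Operad.comp_congr _ ?_ ?_ _ ?_).trans ((T α).one_comp (treeOp α i j a))
    · rw [treeOp_self, tgt_treeOp]
    · rw [preimage_id]; rfl
    · rw [Operad.src_one]; rfl
  induction k using Fin.induction with
  | zero =>
    obtain rfl : j = 0 := le_antisymm (leOfHom h') (Fin.zero_le j)
    exact refl_case h' a
  | succ k ih =>
    by_cases hjk : j = k.succ
    · subst hjk
      exact refl_case h' a
    · have hjk' : j ≤ k.castSucc := Fin.le_castSucc_iff.2 (lt_of_le_of_ne (leOfHom h') hjk)
      rw [treeOp_succ α ((leOfHom h).trans hjk')]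
      let L : List (Σ' (f : (T α).Op) (hs : List (T α).Op), hs.map (T α).tgt = (T α).src f) :=
        (preimage α (homOfLE k.castSucc_lt_succ.le) a).map fun b =>
          ⟨treeOp α j k.castSucc b, (preimage α (homOfLE hjk') b).map (treeOp α i j),
            map_tgt_treeOp α _ b⟩
      have e1 : L.map (fun p => p.1) = (preimage α (homOfLE k.castSucc_lt_succ.le) a).map
          (treeOp α j k.castSucc) := List.map_map
      have e2 : L.flatMap (fun p => p.2.1) = (preimage α h' a).map (treeOp α i j) := by
        rw [← preimage_flatMap α (homOfLE hjk') (homOfLE k.castSucc_lt_succ.le) h' a,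
          List.map_flatMap]
        exact List.flatMap_map ..
      have e3 : L.map (fun p => (T α).comp p.1 p.2.1 p.2.2) =
          (preimage α (homOfLE k.castSucc_lt_succ.le) a).map (treeOp α i k.castSucc) :=
        List.map_map.trans (List.map_congr_left fun b _ => ih (homOfLE hjk') b)
      have e4 : (L.map fun p => p.1).map (T α).tgt =
          (T α).src ((treePresentation α).ofGen ⟨k, a⟩) := by
        rw [e1]; exact map_tgt_treeOp_succ α j k a
      have key := (T α).assoc ((treePresentation α).ofGen ⟨k, a⟩) L e4
      refine (Operad.comp_congr _ ?_ e2.symm _ ?_).trans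
        (key.symm.trans (Operad.comp_congr _ rfl e3 _ _))
      · rw [treeOp_succ α hjk']
        exact Operad.comp_congr _ rfl e1.symm _ _
      · rw [Operad.src_comp]
        refine (List.map_flatMap (l := L)).trans (Eq.trans ?_ (List.flatMap_map _ _ _).symm)
        exact congrArg (fun F => L.flatMap F) (funext fun p => p.2.2)

theorem target_thickList {m : SimplexCategoryᵒᵖ} (g : (thickList α m).Simp 1) :
    thickVertices α m (SimplicialList.target (thickList_isOperadic α m) g) =
      ⟨(g.1.obj 1).as, g.2⟩ := by
  have h := SimplicialList.act_δ_zero (thickList_isOperadic α m) g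
  have h' : (thickList α m).act (SimplexCategory.δ (0 : Fin 2)) g =
      [⟨(nerve (ThickLevel n m)).map (SimplexCategory.δ (0 : Fin 2)).op g.1, g.2⟩] :=
    congrArg (List.map _) (preimage_id α _ g.2)
  rw [← (List.cons.inj (h'.symm.trans h)).1]
  rfl

/-- The augmentation in simplicial degree `m`: the operad morphism from `V_α` in degree `m` to
`T_α` that is the identity on colours and sends the generator `(θ, a)` to
`p_{θ(0),θ(1)}^{(a)}`. -/
noncomputable def augmentationLevel (m : SimplexCategoryᵒᵖ) :
    Operad.OverHom id (thickPresentation α m).operad (T α) :=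
  OperadPresentation.lift (T α) id (fun g => treeOp α (g.1.obj 0).as (g.1.obj 1).as g.2)
    (by
      rintro ⟨θ, a⟩
      refine (src_treeOp α ((ThickLevel.proj n m).map (θ.map (homOfLE (Fin.zero_le 1)))) a).trans ?_
      refine Eq.trans ?_ (List.map_id _).symm
      exact (List.map_map (g := thickVertices α m) (f := fun b =>
        (⟨(nerve (ThickLevel n m)).map (SimplexCategory.δ (1 : Fin 2)).op θ, b⟩ :
          (thickList α m).Simp 0))).symm)
    (fun g => (tgt_treeOp α _ _ _).trans (target_thickList α g).symm)
    (by
      rintro g c ⟨⟨θ, a⟩, hg, rfl⟩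
      have h' : (thickList α m).act (SimplexCategory.σ (0 : Fin 1)) ⟨θ, a⟩ =
          [⟨(nerve (ThickLevel n m)).map (SimplexCategory.σ (0 : Fin 1)).op θ, a⟩] :=
        congrArg (List.map _) (preimage_id α _ a)
      rw [← (List.cons.inj (h'.symm.trans hg)).1]
      exact treeOp_self α _ _)
    (by
      rintro g fs h ⟨⟨θ, a⟩, h0, h2, h1⟩ h'
      have h0' : (thickList α m).act (SimplexCategory.δ (0 : Fin 3)) ⟨θ, a⟩ =
          [⟨(nerve (ThickLevel n m)).map (SimplexCategory.δ (0 : Fin 3)).op θ, a⟩] :=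
        congrArg (List.map _) (preimage_id α _ a)
      have h1' : (thickList α m).act (SimplexCategory.δ (1 : Fin 3)) ⟨θ, a⟩ =
          [⟨(nerve (ThickLevel n m)).map (SimplexCategory.δ (1 : Fin 3)).op θ, a⟩] :=
        congrArg (List.map _) (preimage_id α _ a)
      obtain rfl := (List.cons.inj (h0'.symm.trans h0)).1
      obtain rfl := (List.cons.inj (h1'.symm.trans h1)).1
      subst h2
      refine Eq.trans (Operad.comp_congr _ rfl ?_ _ ?_) (treeOp_comp α
        ((ThickLevel.proj n m).map (θ.map (homOfLE (Fin.zero_le 1))))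
        ((ThickLevel.proj n m).map (θ.map (homOfLE (Fin.le_last 1)))) a)
      · exact List.map_map
      · exact map_tgt_treeOp α _ a)

theorem augmentationLevel_ofGen (m : SimplexCategoryᵒᵖ) (g : (thickList α m).Simp 1) :
    (augmentationLevel α m).toFun ((thickPresentation α m).ofGen g) =
      treeOp α (g.1.obj 0).as (g.1.obj 1).as g.2 :=
  OperadPresentation.lift_ofGen ..

theorem augmentationLevel_thickMap {m m' : SimplexCategoryᵒᵖ} (μ : m ⟶ m') :
    (thickMap α μ).trans (augmentationLevel α m') id rfl = augmentationLevel α m :=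
  OperadPresentation.hom_ext fun g =>
    ((congrArg (augmentationLevel α m').toFun (thickMap_ofGen α μ g)).trans
      (augmentationLevel_ofGen α m' _)).trans (augmentationLevel_ofGen α m g).symm

/-- The morphism of simplicial operads `V_α ⟶ T_α` induced by the augmentation `𝕌_α ⇢ U_α`. -/
noncomputable def augmentation : V α ⟶ SimplicialOperad.discrete (T α) where
  col := id
  app := augmentationLevel α
  naturality μ f :=
    (congrArg (fun F => Operad.OverHom.toFun F f) (augmentationLevel_thickMap α μ)).symm

end LeveledTree

/-!
Write `F_{i,j}` for the poset of subsets of `{i, …, j}` that contain `i` and `j`. In simplicial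
degree `m` the operad `V_α` is generated by the operations `edgeOp α f a`, where `f : i ⟶ j` is a
chain `U_0 ⊆ ⋯ ⊆ U_m` in `F_{i,j}` and `a ∈ A_j`, subject to `edgeOp_id` and `edgeOp_comp`; thus a
morphism out of `V_α` is the same as a compatible family of values of these operations (`edgeLift`,
`edge_hom_ext`).

*The augmentation `V_α ⟶ T_α` is a weak equivalence.* Each `F_{i,j}` has a greatest element
`{i, …, j}`, and these are closed under composition. Hence the augmentation has a section
(`fullSection`) that sends `p_{i,j}^{(a)}` to the constant chain at `{i, …, j}`. Given
`t : [m] ⟶ [1]`, one may replace `U_r` by `{i, …, j}` whenever `t r = 1`. This saturation is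
compatible with identities and composition, so that it extends to `V_α`, and for varying `t` it is
a homotopy from the identity (`t = 0`) to the composite of the augmentation and the section
(`t = 1`), constant on the image of the section. Every map of spaces of operations is therefore the
retraction of a strong deformation retract. Such a retraction is a weak equivalence
(`SSet.isWeakEquivalence_of_deformation`) and a bijection on connected components, and the
augmentation is the identity on colours.

*The operad `V_α` is cofibrant.* Let `φ : K ⟶ Q` be a trivial fibration. It is surjective on colours
(`SimplicialOperad.col_surjective_of_trivialFibration`), and on spaces of operations it has the
right lifting property against all monomorphisms (`SSet.IsKanFibration.rlp_monomorphisms`). After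
the choice of a lift on colours, a morphism `V_α ⟶ Q` is lifted to `K` by induction on the length
`j - i` of chains (`LeveledTree.PartialLift`). The values on chains from `i` to `j` form a simplicial
map out of the nerve of `F_{i,j}`. It is prescribed on the simplicial subset of the chains that
decompose into shorter ones, those for which some `c ∈ U_0` lies strictly between `i` and `j`. The
value does not depend on the `c` at which the chain is cut (`PartialLift.composite_cut`), by
associativity. The lifting property against the inclusion of this simplicial subset provides the
extension to all chains (`PartialLift.exists_extension`).
-/

/-! ### Trivial fibrations and strong deformation retracts of simplicial sets -/

namespace SSet

open MonoidalCategory CartesianMonoidalCategory Simplicial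

section Interval

variable {X Y E : SSet.{u}}

/-- A simplex of `Δ[1]` all of whose vertices are `ε` is degenerate on the vertex `ε`. -/
theorem stdSimplex_one_eq_const {m : SimplexCategoryᵒᵖ} {t : (Δ[1] : SSet.{u}).obj m} {ε : Fin 2}
    (ht : ∀ r, stdSimplex.asOrderHom t r = ε) (x : X.obj m) :
    t = (const (stdSimplex.obj₀Equiv.{u}.symm ε) : X ⟶ Δ[1]).app m x := by
  apply ULift.ext
  apply SimplexCategory.Hom.ext
  ext1
  funext r
  exact ht r

/-- The horn `Λ[1, 1]` consists of the vertex `1`. -/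
theorem fst_ι₁_horn (A : SSet.{u}) : fst A (Λ[1, 1] : SSet.{u}) ≫ ι₁ = A ◁ Λ[1, 1].ι := by
  refine CartesianMonoidalCategory.hom_ext _ _ rfl ?_
  ext m ⟨x, t⟩
  suffices h : ∀ r, stdSimplex.asOrderHom t.1 r = 1 from (stdSimplex_one_eq_const h x).symm
  intro r
  by_contra h
  apply t.2
  have h0 : stdSimplex.asOrderHom t.1 r = 0 := by
    generalize stdSimplex.asOrderHom t.1 r = z at h
    fin_cases z
    · rfl
    · exact absurd rfl h
  ext z
  fin_cases z
  · simpa using ⟨r, h0⟩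
  · simp

/-- An endpoint of the interval, as a constant map to its boundary. -/
noncomputable def boundaryConst (X : SSet.{u}) (ε : Fin 2) : X ⟶ (∂Δ[1] : SSet.{u}) :=
  const ⟨stdSimplex.obj₀Equiv.{u}.symm ε, fun h => by
    obtain ⟨a, ha⟩ := h 0
    obtain ⟨b, hb⟩ := h 1
    exact absurd (ha.symm.trans ((congrArg _ (Subsingleton.elim (α := Fin 1) a b)).trans hb))
      (by decide)⟩

theorem lift_boundaryConst_zero (X : SSet.{u}) :
    lift (𝟙 X) (boundaryConst X 0) ≫ X ◁ ∂Δ[1].ι = ι₀ := rfl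

theorem lift_boundaryConst_one (X : SSet.{u}) :
    lift (𝟙 X) (boundaryConst X 1) ≫ X ◁ ∂Δ[1].ι = ι₁ := rfl

/-- Every simplex of `∂Δ[1]` is a degeneracy of an endpoint `ε`, which is its first vertex. -/
theorem exists_boundary_eq {m : SimplexCategoryᵒᵖ} (t : (∂Δ[1] : SSet.{u}).obj m) (x : X.obj m) :
    ∃ ε, t = (boundaryConst X ε).app m x ∧ stdSimplex.asOrderHom t.1 0 = ε := by
  obtain ⟨t, ht⟩ := t
  obtain ⟨ε, hε⟩ := not_forall.1 (show ¬ ∀ ε, ∃ r, stdSimplex.asOrderHom t r = ε from ht)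
  have hr : ∀ r, stdSimplex.asOrderHom t r = 1 - ε := by
    intro r
    have h : stdSimplex.asOrderHom t r ≠ ε := not_exists.1 hε r
    generalize stdSimplex.asOrderHom t r = z at h
    clear hε
    revert ε z
    decide
  exact ⟨1 - ε, Subtype.ext (stdSimplex_one_eq_const hr x), hr 0⟩

theorem hom_ext_boundary {f g : X ⊗ (∂Δ[1] : SSet.{u}) ⟶ E}
    (h : ∀ ε, lift (𝟙 X) (boundaryConst X ε) ≫ f = lift (𝟙 X) (boundaryConst X ε) ≫ g) :
    f = g := by
  ext m ⟨x, t⟩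
  obtain ⟨ε, ht, -⟩ := exists_boundary_eq t x
  rw [ht]
  exact ConcreteCategory.congr_hom (NatTrans.congr_app (h ε) m) x

/-- The map out of `X ⊗ ∂Δ[1]`, the disjoint union of two copies of `X`, with the given
restrictions. -/
noncomputable def boundaryDesc (f : Fin 2 → (X ⟶ E)) : X ⊗ (∂Δ[1] : SSet.{u}) ⟶ E where
  app m := ↾fun x => (f (stdSimplex.asOrderHom x.2.1 0)).app m x.1
  naturality m m' θ := by
    ext ⟨x, t⟩
    obtain ⟨ε, ht, hε⟩ := exists_boundary_eq t x
    subst ht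
    refine Eq.trans ?_ (ConcreteCategory.congr_hom ((f ε).naturality θ) x)
    rfl

theorem lift_boundaryDesc (f : Fin 2 → (X ⟶ E)) (ε : Fin 2) :
    lift (𝟙 X) (boundaryConst X ε) ≫ boundaryDesc f = f ε := rfl

end Interval

variable {A B C D E W X Y Z : SSet.{u}}

/-- Lifting against a pushout-product `(B ⊗ C) ⊔ (A ⊗ D) ⟶ B ⊗ D`, with the source of the
pushout-product replaced by its two parts. -/
theorem exists_lift_pushoutProduct {i : A ⟶ B} {j : C ⟶ D} {p : E ⟶ W}
    (h : ∀ sq : (curriedTensor SSet.{u}).PushoutObjObj i j, HasLiftingProperty sq.ι p)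
    (f : B ⊗ C ⟶ E) (g : A ⊗ D ⟶ E) (b : B ⊗ D ⟶ W) (hfg : i ▷ C ≫ f = A ◁ j ≫ g)
    (hf : f ≫ p = B ◁ j ≫ b) (hg : g ≫ p = i ▷ D ≫ b) :
    ∃ l : B ⊗ D ⟶ E, B ◁ j ≫ l = f ∧ i ▷ D ≫ l = g ∧ l ≫ p = b := by
  let sq := Functor.PushoutObjObj.ofHasPushout (curriedTensor SSet.{u}) i j
  have := h sq
  have e : CommSq (sq.isPushout.desc f g hfg) sq.ι p b := ⟨by
    apply sq.hom_ext
    · rw [sq.isPushout.inl_desc_assoc, sq.inl_ι_assoc]; exact hf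
    · rw [sq.isPushout.inr_desc_assoc, sq.inr_ι_assoc]; exact hg⟩
  refine ⟨e.lift, ?_, ?_, e.fac_right⟩
  · have := sq.inl ≫= e.fac_left
    rwa [sq.isPushout.inl_desc, sq.inl_ι_assoc] at this
  · have := sq.inr ≫= e.fac_left
    rwa [sq.isPushout.inr_desc, sq.inr_ι_assoc] at this

open modelCategoryQuillen in
theorem exists_anodyne_fibration (f : X ⟶ Y) : ∃ (Z : SSet.{u}) (i : X ⟶ Z) (p : Z ⟶ Y),
    anodyneExtensions i ∧ IsKanFibration p ∧ i ≫ p = f := by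
  let d := MorphismProperty.factorizationData J.{u}.rlp.llp J.{u}.rlp f
  exact ⟨d.Z, d.i, d.p, d.hi, d.hp, d.fac⟩

/-- A Kan fibration `f` that is a weak equivalence is a trivial fibration: if `f = i ≫ p` with `i`
anodyne and `p` a trivial fibration, then `f` lifts against `i`, hence it is a retract of `p`. -/
theorem IsKanFibration.rlp_monomorphisms {f : X ⟶ Y} (hf : IsKanFibration f)
    (hf' : IsWeakEquivalence f) : (MorphismProperty.monomorphisms SSet.{u}).rlp f := by
  obtain ⟨Z, i, p, hi, hp, hip⟩ := hf'
  rw [SSet.rlp_monomorphisms]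
  have : HasLiftingProperty i f := hi f hf
  exact MorphismProperty.of_retract (RetractArrow.ofRightLiftingProperty hip) hp

/-- Homotopy extension and lifting for a monomorphism and a Kan fibration, the homotopy being
prescribed at its end `1`. -/
theorem IsKanFibration.exists_homotopy_lift {p : E ⟶ W} (hp : IsKanFibration p) (i : A ⟶ B) [Mono i]
    (f : B ⟶ E) (g : A ⊗ Δ[1] ⟶ E) (b : B ⊗ Δ[1] ⟶ W) (hfg : i ≫ f = ι₁ ≫ g)
    (hf : f ≫ p = ι₁ ≫ b) (hg : g ≫ p = i ▷ Δ[1] ≫ b) :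
    ∃ l : B ⊗ Δ[1] ⟶ E, ι₁ ≫ l = f ∧ i ▷ Δ[1] ≫ l = g ∧ l ≫ p = b := by
  obtain ⟨l, h1, h2, h3⟩ := exists_lift_pushoutProduct (p := p)
    (fun sq => anodyneExtensions_pushoutObjObjι sq (anodyneExtensions.horn_ι 1) _ hp)
    (fst B (Λ[1, 1] : SSet.{u}) ≫ f) g b
    (by rw [whiskerRight_fst_assoc, hfg, ← fst_ι₁_horn, Category.assoc])
    (by rw [Category.assoc, hf, ← fst_ι₁_horn, Category.assoc]) hg
  refine ⟨l, ?_, h2, h3⟩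
  have hmem : stdSimplex.obj₀Equiv.{u}.symm 1 ∈
      (Λ[1, 1] : (Δ[1] : SSet.{u}).Subcomplex).obj (op ⦋0⦌) := by
    intro h
    obtain ⟨a, ha⟩ | h := (Set.eq_univ_iff_forall.1 h) 0
    · exact absurd (show (1 : Fin 2) = 0 from ha) (by decide)
    · exact absurd h (by decide)
  have h4 : lift (𝟙 B) (const (Y := (Λ[1, 1] : SSet.{u}))
      ⟨stdSimplex.obj₀Equiv.{u}.symm 1, hmem⟩) ≫ B ◁ Λ[1, 1].ι = ι₁ := rfl
  rw [← h4, Category.assoc, h1, lift_fst_assoc, Category.id_comp]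

/-- The inclusion `s` of a strong deformation retract is anodyne: to lift `g : X ⟶ W` along a Kan
fibration `E ⟶ W`, lift the homotopy `H ≫ g` relative to `Y`, starting from the lift `r ≫ f` at its
end `1`. -/
theorem anodyneExtensions_of_deformation {s : Y ⟶ X} {r : X ⟶ Y} (H : X ⊗ Δ[1] ⟶ X)
    (hsr : s ≫ r = 𝟙 Y) (h0 : ι₀ ≫ H = 𝟙 X) (h1 : ι₁ ≫ H = r ≫ s)
    (hs : s ▷ Δ[1] ≫ H = fst Y Δ[1] ≫ s) : anodyneExtensions s := by
  intro E W p hp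
  have : Mono s := mono_of_mono_fac hsr
  refine ⟨fun {f g} sq => ⟨⟨?_⟩⟩⟩
  have hp' : IsKanFibration p := hp
  have h := hp'.exists_homotopy_lift s (r ≫ f) (fst Y Δ[1] ≫ f) (H ≫ g)
    (by rw [reassoc_of% hsr, ← Category.assoc, ι₁_fst, Category.id_comp])
    (by rw [reassoc_of% h1, Category.assoc, sq.w])
    (by rw [reassoc_of% hs, Category.assoc, sq.w])
  refine ⟨ι₀ ≫ h.choose, ?_, ?_⟩
  · rw [← ι₀_comp_assoc, h.choose_spec.2.1, ← Category.assoc, ι₀_fst, Category.id_comp]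
  · rw [Category.assoc, h.choose_spec.2.2, reassoc_of% h0]

/-- A Kan fibration with an anodyne section is a trivial fibration: the identity of
`X` is homotopic to `p ≫ s` over `Y`, so that `s` provides lifts against monomorphisms up to
homotopy, and these are corrected by homotopy extension and lifting. -/
theorem IsKanFibration.rlp_monomorphisms_of_section {p : X ⟶ Y} (hp : IsKanFibration p)
    {s : Y ⟶ X} (hs : anodyneExtensions s) (hsp : s ≫ p = 𝟙 Y) :
    (MorphismProperty.monomorphisms SSet.{u}).rlp p := by
  -- the identity of `X` is homotopic to `p ≫ s` over `Y`
  obtain ⟨H, h1, h2, h3⟩ := exists_lift_pushoutProduct (p := p)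
    (fun sq => anodyneExtensions_pushoutObjObjι' (j := ∂Δ[1].ι) sq hs _ hp)
    (boundaryDesc ![𝟙 X, p ≫ s]) (fst Y Δ[1] ≫ s) (fst X Δ[1] ≫ p)
    (by
      apply hom_ext_boundary
      intro ε
      have e : lift (𝟙 Y) (boundaryConst Y ε) ≫ s ▷ (∂Δ[1] : SSet.{u}) =
        s ≫ lift (𝟙 X) (boundaryConst X ε) := rfl
      rw [reassoc_of% e, lift_boundaryDesc, whiskerLeft_fst_assoc, lift_fst_assoc, Category.id_comp]
      fin_cases ε
      · exact Category.comp_id s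
      · exact (reassoc_of% hsp) s)
    (by
      apply hom_ext_boundary
      intro ε
      rw [← Category.assoc, lift_boundaryDesc, whiskerLeft_fst_assoc, lift_fst_assoc,
        Category.id_comp]
      fin_cases ε
      · exact Category.id_comp p
      · exact (Category.assoc _ _ _).trans ((congrArg _ hsp).trans (Category.comp_id p)))
    (by rw [Category.assoc, hsp, Category.comp_id, whiskerRight_fst_assoc, hsp, Category.comp_id])
  have H0 : ι₀ ≫ H = 𝟙 X := by
    rw [← lift_boundaryConst_zero, Category.assoc, h1]; exact lift_boundaryDesc _ 0
  have H1 : ι₁ ≫ H = p ≫ s := by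
    rw [← lift_boundaryConst_one, Category.assoc, h1]; exact lift_boundaryDesc _ 1
  intro A B i hi
  have : Mono i := hi
  refine ⟨fun {f g} sq => ⟨⟨?_⟩⟩⟩
  -- `g ≫ s` solves the lifting problem up to the homotopy `f ▷ Δ[1] ≫ H` on the source of `i`
  have h := hp.exists_homotopy_lift i (g ≫ s) (f ▷ Δ[1] ≫ H) (fst B Δ[1] ≫ g)
    (by rw [ι₁_comp_assoc, H1, ← Category.assoc, ← sq.w, Category.assoc])
    (by rw [Category.assoc, hsp, Category.comp_id, ← Category.assoc, ι₁_fst, Category.id_comp])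
    (by rw [Category.assoc, h3, whiskerRight_fst_assoc, whiskerRight_fst_assoc, sq.w])
  refine ⟨ι₀ ≫ h.choose, ?_, ?_⟩
  · rw [← ι₀_comp_assoc, h.choose_spec.2.1, ι₀_comp_assoc, H0, Category.comp_id]
  · rw [Category.assoc, h.choose_spec.2.2, ← Category.assoc, ι₀_fst, Category.id_comp]

/-- The retraction `r` of a strong deformation retract is a weak equivalence: if `r = i ≫ p` with
`i` anodyne and `p` a Kan fibration, then `s ≫ i` is an anodyne section of `p`. -/
theorem isWeakEquivalence_of_deformation {s : Y ⟶ X} {r : X ⟶ Y} (H : X ⊗ Δ[1] ⟶ X)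
    (hsr : s ≫ r = 𝟙 Y) (h0 : ι₀ ≫ H = 𝟙 X) (h1 : ι₁ ≫ H = r ≫ s)
    (hs : s ▷ Δ[1] ≫ H = fst Y Δ[1] ≫ s) : IsWeakEquivalence r := by
  obtain ⟨Z, i, p, hi, hp, hip⟩ := exists_anodyne_fibration r
  refine ⟨Z, i, p, hi, ?_, hip⟩
  rw [← SSet.rlp_monomorphisms]
  exact hp.rlp_monomorphisms_of_section (s := s ≫ i)
    (MorphismProperty.comp_mem _ _ _ (anodyneExtensions_of_deformation H hsr h0 h1 hs) hi)
    (by rw [Category.assoc, hip, hsr])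

theorem mapπ₀_bijective_of_deformation {s : Y ⟶ X} {r : X ⟶ Y} (H : X ⊗ Δ[1] ⟶ X)
    (hsr : s ≫ r = 𝟙 Y) (h0 : ι₀ ≫ H = 𝟙 X) (h1 : ι₁ ≫ H = r ≫ s) :
    Function.Bijective (mapπ₀ r) := by
  -- the homotopy restricted to `{x} ⊗ Δ[1]` is an edge from `x` to `s (r x)`
  have hH : ∀ x : π₀ X, mapπ₀ s (mapπ₀ r x) = x := by
    intro x
    induction x with
    | mk x =>
      refine (π₀.sound (Edge.mk (H.app _ (X.σ 0 x, stdSimplex.objEquiv.symm (𝟙 ⦋1⦌))) ?_ ?_)).symm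
      · refine (SSet.δ_naturality_apply H 1 _).symm.trans (Eq.trans (congrArg (H.app _) ?_)
          (ConcreteCategory.congr_hom (NatTrans.congr_app h0 (op ⦋0⦌)) x))
        exact Prod.ext (SSet.δ_comp_σ_succ_apply 0 x)
          (stdSimplex_one_eq_const (fun (r : Fin 1) => by fin_cases r; rfl) x)
      · refine (SSet.δ_naturality_apply H 0 _).symm.trans (Eq.trans (congrArg (H.app _) ?_)
          (ConcreteCategory.congr_hom (NatTrans.congr_app h1 (op ⦋0⦌)) x))
        exact Prod.ext (SSet.δ_comp_σ_self_apply 0 x)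
          (stdSimplex_one_eq_const (fun (r : Fin 1) => by fin_cases r; rfl) x)
  exact ⟨fun x y h => by rw [← hH x, h, hH y], fun y => ⟨mapπ₀ s y, by
    rw [← mapπ₀_comp_apply, hsr, mapπ₀_id_apply]⟩⟩

end SSet

/-! ### Generators and relations of `V_α` -/

namespace LeveledTree

variable {n : ℕ} (α : ComposableArrows AugmentedSimplexCategory n)

section Edges

variable {m : SimplexCategoryᵒᵖ}

/-- The `1`-simplex `(f, a)` of `𝕌_α^{(m)}`. -/
def edge {i j : ThickLevel n m} (f : i ⟶ j) (a : Vertex α j.as) : (thickList α m).Simp 1 :=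
  ⟨ComposableArrows.mk₁ f, a⟩

/-- Every `1`-simplex of `𝕌_α^{(m)}` is of the form `edge α f a`. -/
theorem eq_edge (θ : ComposableArrows (ThickLevel n m) 1) (a : Vertex α (θ.obj 1).as) :
    (⟨θ, a⟩ : (thickList α m).Simp 1) = edge α (θ.map (homOfLE (Fin.zero_le 1))) a := by
  obtain ⟨i, j, f, rfl⟩ := ComposableArrows.mk₁_surjective θ
  rfl

theorem src_edge {i j : ThickLevel n m} (f : i ⟶ j) (a : Vertex α j.as) :
    (thickPresentation α m).src (edge α f a) =
      (preimage α ((ThickLevel.proj n m).map f) a).map fun b => ⟨i.as, b⟩ :=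
  List.map_map

theorem tgt_edge {i j : ThickLevel n m} (f : i ⟶ j) (a : Vertex α j.as) :
    (thickPresentation α m).tgt (edge α f a) = ⟨j.as, a⟩ :=
  target_thickList α (edge α f a)

/-- The relation given by the degenerate `1`-simplices: identities of chains are units. -/
theorem isUnit_edge (i : ThickLevel n m) (a : Vertex α i.as) :
    (thickPresentation α m).IsUnit (edge α (𝟙 i) a) ⟨i.as, a⟩ := by
  refine ⟨⟨ComposableArrows.mk₀ i, a⟩, ?_, rfl⟩
  refine (congrArg (List.map _) (preimage_id α _ a)).trans (congrArg (fun x => [x]) ?_)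
  exact (eq_edge α ((nerve (ThickLevel n m)).map (SimplexCategory.σ (0 : Fin 1)).op
    (ComposableArrows.mk₀ i)) a).trans rfl

/-- The relation given by the `2`-simplices: a composite of chains is an operadic composite. -/
theorem isComp_edge {i j k : ThickLevel n m} (f : i ⟶ j) (g : j ⟶ k) (a : Vertex α k.as) :
    (thickPresentation α m).IsComp (edge α g a)
      ((preimage α ((ThickLevel.proj n m).map g) a).map (edge α f)) (edge α (f ≫ g) a) := by
  refine ⟨⟨ComposableArrows.mk₂ f g, a⟩, ?_, ?_, ?_⟩
  · refine (congrArg (List.map _) (preimage_id α _ a)).trans (congrArg (fun x => [x]) ?_)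
    exact (eq_edge α ((nerve (ThickLevel n m)).map (SimplexCategory.δ (0 : Fin 3)).op
      (ComposableArrows.mk₂ f g)) a).trans rfl
  · refine List.map_congr_left fun b _ => ?_
    exact (eq_edge α ((nerve (ThickLevel n m)).map (SimplexCategory.δ (2 : Fin 3)).op
      (ComposableArrows.mk₂ f g)) b).trans rfl
  · refine (congrArg (List.map _) (preimage_id α _ a)).trans (congrArg (fun x => [x]) ?_)
    exact (eq_edge α ((nerve (ThickLevel n m)).map (SimplexCategory.δ (1 : Fin 3)).op
      (ComposableArrows.mk₂ f g)) a).trans rfl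

/-- The operation of `V_α` in simplicial degree `m` given by the generator `(f, a)`. -/
noncomputable def edgeOp {i j : ThickLevel n m} (f : i ⟶ j) (a : Vertex α j.as) :
    (thickPresentation α m).operad.Op :=
  (thickPresentation α m).ofGen (edge α f a)

theorem src_edgeOp {i j : ThickLevel n m} (f : i ⟶ j) (a : Vertex α j.as) :
    (thickPresentation α m).operad.src (edgeOp α f a) =
      (preimage α ((ThickLevel.proj n m).map f) a).map fun b => ⟨i.as, b⟩ :=
  ((thickPresentation α m).src_ofGen _).trans (src_edge α f a)

theorem tgt_edgeOp {i j : ThickLevel n m} (f : i ⟶ j) (a : Vertex α j.as) :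
    (thickPresentation α m).operad.tgt (edgeOp α f a) = ⟨j.as, a⟩ :=
  ((thickPresentation α m).tgt_ofGen _).trans (tgt_edge α f a)

theorem edgeOp_id (i : ThickLevel n m) (a : Vertex α i.as) :
    edgeOp α (𝟙 i) a = (thickPresentation α m).operad.one ⟨i.as, a⟩ :=
  OperadPresentation.ofGen_of_isUnit _ (isUnit_edge α i a)

theorem map_tgt_edgeOp {i j k : ThickLevel n m} (f : i ⟶ j) (g : j ⟶ k) (a : Vertex α k.as) :
    ((preimage α ((ThickLevel.proj n m).map g) a).map (edgeOp α f)).map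
      (thickPresentation α m).operad.tgt = (thickPresentation α m).operad.src (edgeOp α g a) :=
  List.map_map.trans ((List.map_congr_left fun b _ => tgt_edgeOp α f b).trans
    (src_edgeOp α g a).symm)

theorem edgeOp_comp {i j k : ThickLevel n m} (f : i ⟶ j) (g : j ⟶ k) (a : Vertex α k.as)
    (h : ((preimage α ((ThickLevel.proj n m).map g) a).map (edgeOp α f)).map
      (thickPresentation α m).operad.tgt = (thickPresentation α m).operad.src (edgeOp α g a)) :
    (thickPresentation α m).operad.comp (edgeOp α g a)
      ((preimage α ((ThickLevel.proj n m).map g) a).map (edgeOp α f)) h =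
      edgeOp α (f ≫ g) a := by
  have e : ((preimage α ((ThickLevel.proj n m).map g) a).map (edgeOp α f)) =
    ((preimage α ((ThickLevel.proj n m).map g) a).map (edge α f)).map
      (thickPresentation α m).ofGen := List.map_map.symm
  refine (Operad.comp_congr _ rfl e _ (e ▸ h)).trans ?_
  exact OperadPresentation.comp_ofGen (isComp_edge α f g a) _

/-- Morphisms out of `τ₁ 𝕌_α^{(m)}` that agree on the generators are equal. -/
theorem edge_hom_ext {D : Type v} {Q : Operad D} {φ : Colour α → D}
    {F G : Operad.OverHom φ (thickPresentation α m).operad Q}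
    (h : ∀ {i j : ThickLevel n m} (f : i ⟶ j) (a : Vertex α j.as),
      F.toFun (edgeOp α f a) = G.toFun (edgeOp α f a)) : F = G :=
  OperadPresentation.hom_ext fun ⟨θ, a⟩ => by
    rw [eq_edge α θ a]
    exact h _ a

section Lift

variable {D : Type v} (Q : Operad D) (φ : Colour α → D)
  (F : ∀ ⦃i j : ThickLevel n m⦄, (i ⟶ j) → Vertex α j.as → Q.Op)
  (hsrc : ∀ ⦃i j : ThickLevel n m⦄ (f : i ⟶ j) (a : Vertex α j.as), Q.src (F f a) =
    (preimage α ((ThickLevel.proj n m).map f) a).map fun b => φ ⟨i.as, b⟩)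
  (htgt : ∀ ⦃i j : ThickLevel n m⦄ (f : i ⟶ j) (a : Vertex α j.as), Q.tgt (F f a) = φ ⟨j.as, a⟩)
  (hid : ∀ (i : ThickLevel n m) (a : Vertex α i.as), F (𝟙 i) a = Q.one (φ ⟨i.as, a⟩))
  (hcomp : ∀ ⦃i j k : ThickLevel n m⦄ (f : i ⟶ j) (g : j ⟶ k) (a : Vertex α k.as) h,
    Q.comp (F g a) ((preimage α ((ThickLevel.proj n m).map g) a).map (F f)) h = F (f ≫ g) a)

/-- The morphism out of `τ₁ 𝕌_α^{(m)}` that takes the value `F f a` on the generator `(f, a)`, for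
`F` compatible with identities and composition. -/
noncomputable def edgeLift : Operad.OverHom φ (thickPresentation α m).operad Q :=
  OperadPresentation.lift Q φ (fun g => F (g.1.map (homOfLE (Fin.zero_le 1))) g.2)
    (by
      rintro ⟨θ, a⟩
      refine (hsrc _ a).trans (Eq.symm ?_)
      refine (congrArg (fun x => ((thickPresentation α m).src x).map φ) (eq_edge α θ a)).trans ?_
      exact (congrArg (List.map φ) (src_edge α _ a)).trans List.map_map)
    (by
      rintro ⟨θ, a⟩
      refine (htgt _ a).trans (congrArg φ (Eq.symm ?_))
      exact (congrArg (thickPresentation α m).tgt (eq_edge α θ a)).trans (tgt_edge α _ a))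
    (by
      rintro g c ⟨⟨θ, a⟩, hg, rfl⟩
      have h' : (thickList α m).act (SimplexCategory.σ (0 : Fin 1)) ⟨θ, a⟩ =
          [⟨(nerve (ThickLevel n m)).map (SimplexCategory.σ (0 : Fin 1)).op θ, a⟩] :=
        congrArg (List.map _) (preimage_id α _ a)
      rw [← (List.cons.inj (h'.symm.trans hg)).1]
      refine Eq.trans ?_ (hid (θ.obj 0) a)
      exact congrArg (fun f => F f a) (θ.map_id 0))
    (by
      rintro g fs h ⟨⟨θ, a⟩, h0, h2, h1⟩ h'
      have h0' : (thickList α m).act (SimplexCategory.δ (0 : Fin 3)) ⟨θ, a⟩ =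
          [⟨(nerve (ThickLevel n m)).map (SimplexCategory.δ (0 : Fin 3)).op θ, a⟩] :=
        congrArg (List.map _) (preimage_id α _ a)
      have h1' : (thickList α m).act (SimplexCategory.δ (1 : Fin 3)) ⟨θ, a⟩ =
          [⟨(nerve (ThickLevel n m)).map (SimplexCategory.δ (1 : Fin 3)).op θ, a⟩] :=
        congrArg (List.map _) (preimage_id α _ a)
      obtain rfl := (List.cons.inj (h0'.symm.trans h0)).1
      obtain rfl := (List.cons.inj (h1'.symm.trans h1)).1
      subst h2
      have e : F (θ.map (homOfLE (Fin.zero_le 1)) ≫ θ.map (homOfLE (Fin.le_last 1))) a =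
          F (θ.map (homOfLE (Fin.zero_le 2))) a :=
        congrArg (fun f => F f a) (θ.map_comp _ _).symm
      refine Eq.trans ?_ ((hcomp (θ.map (homOfLE (Fin.zero_le 1)))
        (θ.map (homOfLE (Fin.le_last 1))) a ?_).trans e)
      · exact Operad.comp_congr _ rfl List.map_map _ _
      · exact (congrArg (List.map Q.tgt) (List.map_map (g := fun g : (thickList α m).Simp 1 =>
          F (g.1.map (homOfLE (Fin.zero_le 1))) g.2))).symm.trans h')

theorem edgeLift_edgeOp {i j : ThickLevel n m} (f : i ⟶ j) (a : Vertex α j.as) :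
    (edgeLift α Q φ F hsrc htgt hid hcomp).toFun (edgeOp α f a) = F f a :=
  OperadPresentation.lift_ofGen ..

end Lift

theorem thickMap_edgeOp {m' : SimplexCategoryᵒᵖ} (μ : m ⟶ m') {i j : ThickLevel n m} (f : i ⟶ j)
    (a : Vertex α j.as) : Operad.OverHom.toFun (thickMap α μ) (edgeOp α f a) =
      edgeOp α ((ThickLevel.operator n μ).map f) a :=
  (thickMap_ofGen α μ _).trans
    (congrArg (thickPresentation α m').ofGen
      ((eq_edge α ((nerveMap (ThickLevel.operator n μ)).app
        (op (SimplexCategory.mk 1)) (ComposableArrows.mk₁ f)) a).trans rfl))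

theorem augmentationLevel_edgeOp {i j : ThickLevel n m} (f : i ⟶ j) (a : Vertex α j.as) :
    (augmentationLevel α m).toFun (edgeOp α f a) = treeOp α i.as j.as a :=
  augmentationLevel_ofGen α m _

end Edges
end LeveledTree

/-! ### Saturation of chains and the weak equivalence -/

namespace ThickLevel

open SimplicialThickening Simplicial

variable {n : ℕ}

/-- Inclusions of sets are morphisms of paths. -/
def pathHomMk {i j : SimplicialThickening (Fin (n + 1))} {p q : i ⟶ j} (h : p.I ⊆ q.I) : p ⟶ q :=
  ⟨⟨⟨h⟩⟩⟩

theorem subset_of_pathHom {i j : SimplicialThickening (Fin (n + 1))} {p q : i ⟶ j} (f : p ⟶ q) :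
    p.I ⊆ q.I :=
  leOfHom f.hom

variable {m : SimplexCategoryᵒᵖ}

/-- The `r`-th subset of a chain. -/
abbrev subsetAt {i j : ThickLevel n m} (f : i ⟶ j) (r : Fin (m.unop.len + 1)) :
    Set (Fin (n + 1)) :=
  SimplicialThickening.Path.I (CategoryTheory.Functor.obj f r)

theorem hom_ext {i j : ThickLevel n m} {f g : i ⟶ j}
    (h : ∀ r l, l ∈ subsetAt f r ↔ l ∈ subsetAt g r) : f = g :=
  nerve.ext_of_isThin (funext fun r => SimplicialThickening.hom_ext _ _ _ _ (h r))

/-- The chain with the given subsets. -/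
def homMk {i j : ThickLevel n m} (p : Fin (m.unop.len + 1) → SimplicialThickening.Path i.as j.as)
    (hp : ∀ r s, r ≤ s → ((p r).I : Set (Fin (n + 1))) ⊆ (p s).I) : i ⟶ j :=
  show Fin (m.unop.len + 1) ⥤ (SimplicialThickening.mk i.as ⟶ SimplicialThickening.mk j.as) from
  { obj := p
    map := fun h => pathHomMk (hp _ _ (leOfHom h))
    map_id := fun _ => Subsingleton.elim _ _
    map_comp := fun _ _ => Subsingleton.elim _ _ }

theorem le_of_hom {i j : ThickLevel n m} (f : i ⟶ j) : i.as ≤ j.as :=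
  SimplicialThickening.Path.le (CategoryTheory.Functor.obj f 0)

theorem subsetAt_mono {i j : ThickLevel n m} (f : i ⟶ j) {r s : Fin (m.unop.len + 1)}
    (h : r ≤ s) : subsetAt f r ⊆ subsetAt f s :=
  subset_of_pathHom (CategoryTheory.Functor.map f (homOfLE h))

theorem subsetAt_comp {i j k : ThickLevel n m} (f : i ⟶ j) (g : j ⟶ k) (r) :
    subsetAt (f ≫ g) r = subsetAt f r ∪ subsetAt g r := rfl

theorem subsetAt_id (i : ThickLevel n m) (r) : subsetAt (𝟙 i) r = {i.as} := rfl

theorem subsetAt_homMk {i j : ThickLevel n m}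
    (p : Fin (m.unop.len + 1) → SimplicialThickening.Path i.as j.as)
    (hp : ∀ r s, r ≤ s → ((p r).I : Set (Fin (n + 1))) ⊆ (p s).I) (r) :
    subsetAt (homMk p hp) r = (p r).I := rfl

theorem subsetAt_subset {i j : ThickLevel n m} (f : i ⟶ j) (r) :
    subsetAt f r ⊆ Set.Icc i.as j.as :=
  fun _ h => ⟨SimplicialThickening.Path.left_le _ _ h, SimplicialThickening.Path.le_right _ _ h⟩

/-- The constant chain at `{i, …, j}`. -/
def full {i j : ThickLevel n m} (h : i.as ≤ j.as) : i ⟶ j :=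
  homMk (fun _ => ⟨Set.Icc i.as j.as, ⟨le_rfl, h⟩, ⟨h, le_rfl⟩, fun _ h => h.1, fun _ h => h.2⟩)
    (fun _ _ _ => subset_rfl)

theorem full_self (i : ThickLevel n m) (h : i.as ≤ i.as) : full h = 𝟙 i :=
  hom_ext fun r l => by simp [full, subsetAt_homMk, subsetAt_id]

theorem full_comp {i j k : ThickLevel n m} (h : i.as ≤ j.as) (h' : j.as ≤ k.as) :
    full h ≫ full h' = full (h.trans h') :=
  hom_ext fun r l => by
    simp only [full, subsetAt_homMk, subsetAt_comp, Set.Icc_union_Icc_eq_Icc h h']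

/-- For `t : [m] ⟶ [1]`, the chain obtained from `U_0 ⊆ ⋯ ⊆ U_m` by replacing `U_r` by
`{i, …, j}` where `t r = 1`. -/
def saturate (t : (Δ[1] : SSet.{0}).obj m) {i j : ThickLevel n m} (f : i ⟶ j) : i ⟶ j :=
  homMk (fun r =>
    { I := {l | l ∈ subsetAt f r ∨ (SSet.stdSimplex.asOrderHom t r = 1 ∧ l ∈ Set.Icc i.as j.as)}
      left := Or.inl (SimplicialThickening.Path.left _)
      right := Or.inl (SimplicialThickening.Path.right _)
      left_le := fun _ h => h.elim (fun h => (subsetAt_subset f r h).1) fun h => h.2.1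
      le_right := fun _ h => h.elim (fun h => (subsetAt_subset f r h).2) fun h => h.2.2 })
    (by
      intro r s hrs l hl
      refine hl.imp (fun h => subsetAt_mono f hrs h) (fun h => ⟨?_, h.2⟩)
      have := (SSet.stdSimplex.asOrderHom t).monotone hrs
      rw [h.1] at this
      exact le_antisymm (Fin.le_last _) this)

theorem mem_subsetAt_saturate (t : (Δ[1] : SSet.{0}).obj m) {i j : ThickLevel n m} (f : i ⟶ j)
    (r l) : l ∈ subsetAt (saturate t f) r ↔
      l ∈ subsetAt f r ∨ (SSet.stdSimplex.asOrderHom t r = 1 ∧ l ∈ Set.Icc i.as j.as) := Iff.rfl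

theorem saturate_id (t : (Δ[1] : SSet.{0}).obj m) (i : ThickLevel n m) :
    saturate t (𝟙 i) = 𝟙 i :=
  hom_ext fun r l => by
    rw [mem_subsetAt_saturate, subsetAt_id, Set.Icc_self]
    tauto

theorem saturate_comp (t : (Δ[1] : SSet.{0}).obj m) {i j k : ThickLevel n m} (f : i ⟶ j)
    (g : j ⟶ k) : saturate t (f ≫ g) = saturate t f ≫ saturate t g :=
  hom_ext fun r l => by
    rw [mem_subsetAt_saturate, subsetAt_comp, subsetAt_comp, Set.mem_union, Set.mem_union,
      mem_subsetAt_saturate, mem_subsetAt_saturate,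
      ← Set.Icc_union_Icc_eq_Icc (le_of_hom f) (le_of_hom g), Set.mem_union]
    tauto

theorem saturate_full (t : (Δ[1] : SSet.{0}).obj m) {i j : ThickLevel n m} (h : i.as ≤ j.as) :
    saturate t (full h : i ⟶ j) = full h :=
  hom_ext fun r l => by
    rw [mem_subsetAt_saturate, full, subsetAt_homMk]
    tauto

theorem saturate_of_zero {t : (Δ[1] : SSet.{0}).obj m}
    (ht : ∀ r, SSet.stdSimplex.asOrderHom t r = 0) {i j : ThickLevel n m} (f : i ⟶ j) :
    saturate t f = f :=
  hom_ext fun r l => by simp [mem_subsetAt_saturate, ht]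

theorem saturate_of_one {t : (Δ[1] : SSet.{0}).obj m}
    (ht : ∀ r, SSet.stdSimplex.asOrderHom t r = 1) {i j : ThickLevel n m} (f : i ⟶ j) :
    saturate t f = full (le_of_hom f) :=
  hom_ext fun r l => by
    rw [mem_subsetAt_saturate, full, subsetAt_homMk]
    have := @subsetAt_subset n m i j f r l
    simp [ht]
    tauto

end ThickLevel

namespace LeveledTree

open Simplicial

variable {n : ℕ} (α : ComposableArrows AugmentedSimplexCategory n) {m : SimplexCategoryᵒᵖ}

/-- The endomorphism of `V_α` in simplicial degree `m` induced by saturation of chains. -/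
noncomputable def saturation (t : (Δ[1] : SSet.{0}).obj m) :
    Operad.OverHom id (thickPresentation α m).operad (thickPresentation α m).operad :=
  edgeLift α _ id (fun _ _ f a => edgeOp α (ThickLevel.saturate t f) a)
    (fun _ _ f a => src_edgeOp α (ThickLevel.saturate t f) a)
    (fun _ _ f a => tgt_edgeOp α (ThickLevel.saturate t f) a)
    (fun i a => by rw [ThickLevel.saturate_id]; exact edgeOp_id α i a)
    (fun _ _ _ f g a h => by
      rw [ThickLevel.saturate_comp]
      exact edgeOp_comp α (ThickLevel.saturate t f) (ThickLevel.saturate t g) a h)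

theorem saturation_edgeOp (t : (Δ[1] : SSet.{0}).obj m) {i j : ThickLevel n m} (f : i ⟶ j)
    (a : Vertex α j.as) : (saturation α t).toFun (edgeOp α f a) =
      edgeOp α (ThickLevel.saturate t f) a :=
  edgeLift_edgeOp α _ _ _ _ _ _ _ f a

variable (m) in
/-- The morphism from `T_α` to `V_α` in simplicial degree `m` that sends the generators to
full chains. -/
noncomputable def fullSection : Operad.OverHom id (T α) (thickPresentation α m).operad :=
  OperadPresentation.lift _ id
    (fun g => edgeOp α (ThickLevel.full (m := m) (i := ⟨g.1.castSucc⟩) (j := ⟨g.1.succ⟩)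
      g.1.castSucc_lt_succ.le) g.2)
    (fun _ => (src_edgeOp α _ _).trans (List.map_id _).symm) (fun _ => tgt_edgeOp α _ _)
    (fun _ _ h => h.elim) (fun _ _ _ h => h.elim)

theorem fullSection_ofGen (g : (treePresentation α).Gen) :
    (fullSection α m).toFun ((treePresentation α).ofGen g) =
      edgeOp α (ThickLevel.full (m := m) (i := ⟨g.1.castSucc⟩) (j := ⟨g.1.succ⟩)
      g.1.castSucc_lt_succ.le) g.2 :=
  OperadPresentation.lift_ofGen ..

/-- The section sends all composites `p_{i,j}^{(a)}` of generators to full chains, since full chains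
are closed under composition. -/
theorem fullSection_treeOp (i j : Fin (n + 1)) (h : i ≤ j) (a : Vertex α j) :
    (fullSection α m).toFun (treeOp α i j a) =
      edgeOp α (ThickLevel.full (m := m) (i := ⟨i⟩) (j := ⟨j⟩) h) a := by
  have refl_case : ∀ (i : Fin (n + 1)) (a : Vertex α i) h,
      (fullSection α m).toFun (treeOp α i i a) =
      edgeOp α (ThickLevel.full (m := m) (i := ⟨i⟩) (j := ⟨i⟩) h) a := by
    intro i a h
    rw [treeOp_self, ThickLevel.full_self, Operad.OverHom.map_one]
    exact (edgeOp_id α ⟨i⟩ a).symm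
  induction j using Fin.induction with
  | zero =>
    obtain rfl : i = 0 := le_antisymm h (Fin.zero_le i)
    exact refl_case _ a h
  | succ j ih =>
    by_cases hij : i = j.succ
    · subst hij
      exact refl_case _ a h
    · have hij' : i ≤ j.castSucc := Fin.le_castSucc_iff.2 (lt_of_le_of_ne h hij)
      rw [treeOp_succ α hij', Operad.OverHom.map_comp]
      have e := edgeOp_comp α (ThickLevel.full (m := m) (i := ⟨i⟩) (j := ⟨j.castSucc⟩) hij')
        (ThickLevel.full (m := m) (i := ⟨j.castSucc⟩) (j := ⟨j.succ⟩) j.castSucc_lt_succ.le) a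
      rw [ThickLevel.full_comp] at e
      refine (Operad.comp_congr _ (fullSection_ofGen α _) ?_ _ ?_).trans (e ?_)
      · exact List.map_map.trans (List.map_congr_left fun b _ => ih hij' b)
      all_goals exact map_tgt_edgeOp α _ _ a

theorem augmentationLevel_fullSection (x : (T α).Op) :
    (augmentationLevel α m).toFun ((fullSection α m).toFun x) = x := by
  suffices h : (fullSection α m).trans (augmentationLevel α m) id rfl = Operad.OverHom.refl _ from
    congrArg (fun F => Operad.OverHom.toFun F x) h
  refine OperadPresentation.hom_ext fun ⟨j, a⟩ => ?_
  refine (congrArg (augmentationLevel α m).toFun (fullSection_ofGen α ⟨j, a⟩)).trans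
    ((augmentationLevel_edgeOp α _ a).trans ?_)
  refine (treeOp_succ α le_rfl a).trans (Eq.trans ?_ ((T α).comp_one _))
  refine Operad.comp_congr _ rfl ?_ _ _
  refine Eq.trans ?_ (congrArg (List.map _) ((treePresentation α).src_ofGen ⟨j, a⟩)).symm
  exact (List.map_congr_left fun b _ => treeOp_self α _ b).trans List.map_map.symm

theorem saturation_fullSection (t : (Δ[1] : SSet.{0}).obj m) (x : (T α).Op) :
    (saturation α t).toFun ((fullSection α m).toFun x) = (fullSection α m).toFun x := by
  suffices h : (fullSection α m).trans (saturation α t) id rfl = fullSection α m from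
    congrArg (fun F => Operad.OverHom.toFun F x) h
  refine OperadPresentation.hom_ext fun ⟨j, a⟩ => ?_
  refine (congrArg (saturation α t).toFun (fullSection_ofGen α ⟨j, a⟩)).trans
    ((saturation_edgeOp α t _ a).trans ?_)
  rw [ThickLevel.saturate_full]
  exact (fullSection_ofGen α ⟨j, a⟩).symm

theorem saturation_of_zero {t : (Δ[1] : SSet.{0}).obj m}
    (ht : ∀ r, SSet.stdSimplex.asOrderHom t r = 0) (x : (thickPresentation α m).operad.Op) :
    (saturation α t).toFun x = x := by
  suffices h : saturation α t = Operad.OverHom.refl _ from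
    congrArg (fun F => Operad.OverHom.toFun F x) h
  refine edge_hom_ext α fun f a => (saturation_edgeOp α t f a).trans ?_
  rw [ThickLevel.saturate_of_zero ht]
  rfl

theorem saturation_of_one {t : (Δ[1] : SSet.{0}).obj m}
    (ht : ∀ r, SSet.stdSimplex.asOrderHom t r = 1) (x : (thickPresentation α m).operad.Op) :
    (saturation α t).toFun x = (fullSection α m).toFun ((augmentationLevel α m).toFun x) := by
  suffices h : saturation α t = (augmentationLevel α m).trans (fullSection α m) id rfl from
    congrArg (fun F => Operad.OverHom.toFun F x) h
  refine edge_hom_ext α fun f a => (saturation_edgeOp α t f a).trans ?_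
  rw [ThickLevel.saturate_of_one ht]
  exact ((congrArg (fullSection α m).toFun (augmentationLevel_edgeOp α f a)).trans
    (fullSection_treeOp α _ _ (ThickLevel.le_of_hom f) a)).symm

theorem act_saturation {m' : SimplexCategoryᵒᵖ} (μ : m ⟶ m') (t : (Δ[1] : SSet.{0}).obj m)
    (x : (thickPresentation α m).operad.Op) :
    (V α).act μ ((saturation α t).toFun x) =
      (saturation α ((Δ[1] : SSet.{0}).map μ t)).toFun ((V α).act μ x) := by
  suffices h : (saturation α t).trans (thickMap α μ) id rfl =
      Operad.OverHom.trans (thickMap α μ) (saturation α ((Δ[1] : SSet.{0}).map μ t)) id rfl from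
    congrArg (fun F => Operad.OverHom.toFun F x) h
  refine edge_hom_ext α fun f a => ?_
  refine (congrArg (Operad.OverHom.toFun (thickMap α μ)) (saturation_edgeOp α t f a)).trans
    ((thickMap_edgeOp α μ _ a).trans ?_)
  exact ((congrArg (saturation α ((Δ[1] : SSet.{0}).map μ t)).toFun (thickMap_edgeOp α μ f a)).trans
    (saturation_edgeOp α ((Δ[1] : SSet.{0}).map μ t) ((ThickLevel.operator n μ).map f) a)).symm

theorem act_fullSection {m' : SimplexCategoryᵒᵖ} (μ : m ⟶ m') (x : (T α).Op) :
    (V α).act μ ((fullSection α m).toFun x) = (fullSection α m').toFun x := by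
  suffices h : (fullSection α m).trans (thickMap α μ) id rfl = fullSection α m' from
    congrArg (fun F => Operad.OverHom.toFun F x) h
  refine OperadPresentation.hom_ext fun ⟨j, a⟩ => ?_
  exact (congrArg (Operad.OverHom.toFun (thickMap α μ)) (fullSection_ofGen α ⟨j, a⟩)).trans
    ((thickMap_edgeOp α μ _ a).trans (fullSection_ofGen α ⟨j, a⟩).symm)

section Space

open MonoidalCategory CartesianMonoidalCategory

variable (x : List (Colour α)) (y : Colour α)

/-- The homotopy on the spaces of operations of `V_α` given by saturation of chains, from the
identity to the retraction onto the operations of `T_α`. -/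
noncomputable def saturationHomotopy : (V α).space x y ⊗ Δ[1] ⟶ (V α).space x y where
  app m := ↾fun z => ⟨(saturation α z.2).toFun z.1.1,
    ((saturation α z.2).src_toFun _).trans ((List.map_id _).trans z.1.2.1),
    ((saturation α z.2).tgt_toFun _).trans z.1.2.2⟩
  naturality m m' μ := by
    ext z
    exact Subtype.ext (act_saturation α μ z.2 z.1.1).symm

/-- The section of the augmentation on spaces of operations, with values composites of full
chains. -/
noncomputable def spaceSection :
    (SimplicialOperad.discrete (T α)).space (x.map (augmentation α).col) ((augmentation α).col y) ⟶
      (V α).space x y where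
  app m := ↾fun z => ⟨(fullSection α m).toFun z.1,
    ((fullSection α m).src_toFun _).trans ((List.map_id _).trans (z.2.1.trans (List.map_id _))),
    ((fullSection α m).tgt_toFun _).trans z.2.2⟩
  naturality m m' μ := by
    ext z
    exact Subtype.ext (act_fullSection α μ z.1).symm

theorem spaceSection_mapSpace :
    spaceSection α x y ≫ (augmentation α).mapSpace x y = 𝟙 _ := by
  ext m z
  exact Subtype.ext (augmentationLevel_fullSection α z.1)

theorem ι₀_saturationHomotopy : SSet.ι₀ ≫ saturationHomotopy α x y = 𝟙 _ := by
  ext m z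
  exact Subtype.ext (saturation_of_zero α (fun _ => rfl) z.1)

theorem ι₁_saturationHomotopy : SSet.ι₁ ≫ saturationHomotopy α x y =
    (augmentation α).mapSpace x y ≫ spaceSection α x y := by
  ext m z
  exact Subtype.ext (saturation_of_one α (fun _ => rfl) z.1)

theorem spaceSection_saturationHomotopy : spaceSection α x y ▷ Δ[1] ≫ saturationHomotopy α x y =
    fst _ Δ[1] ≫ spaceSection α x y := by
  ext m z
  exact Subtype.ext (saturation_fullSection α z.2 z.1.1)

theorem isWeakEquivalence_mapSpace_augmentation :
    SSet.IsWeakEquivalence ((augmentation α).mapSpace x y) :=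
  SSet.isWeakEquivalence_of_deformation (saturationHomotopy α x y)
    (spaceSection_mapSpace α x y) (ι₀_saturationHomotopy α x y) (ι₁_saturationHomotopy α x y)
    (spaceSection_saturationHomotopy α x y)

end Space

theorem hoFunctor_augmentation_isEquivalence : (augmentation α).hoFunctor.IsEquivalence where
  faithful := ⟨fun {a b} => (SSet.mapπ₀_bijective_of_deformation _
    (spaceSection_mapSpace α [a.col] b.col) (ι₀_saturationHomotopy α _ _)
    (ι₁_saturationHomotopy α _ _)).1⟩
  full := ⟨fun {a b} => (SSet.mapπ₀_bijective_of_deformation _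
    (spaceSection_mapSpace α [a.col] b.col) (ι₀_saturationHomotopy α _ _)
    (ι₁_saturationHomotopy α _ _)).2⟩
  essSurj := ⟨fun c => ⟨⟨c.col⟩, ⟨Iso.refl _⟩⟩⟩

theorem weakEquivalence_augmentation : WeakEquivalence (augmentation α) :=
  ⟨⟨isWeakEquivalence_mapSpace_augmentation α, hoFunctor_augmentation_isEquivalence α⟩⟩

end LeveledTree

/-! ### Decomposable chains and cofibrancy -/

namespace ThickLevel

variable {n : ℕ} {m : SimplexCategoryᵒᵖ}

/-- The part below `c` of a chain all of whose subsets contain `c`. -/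
def cutLeft {i j : ThickLevel n m} (f : i ⟶ j) (c : Fin (n + 1)) (hc : c ∈ subsetAt f 0) :
    i ⟶ ⟨c⟩ :=
  homMk (fun r =>
    { I := subsetAt f r ∩ Set.Iic c
      left := ⟨SimplicialThickening.Path.left _, (subsetAt_subset f 0 hc).1⟩
      right := ⟨subsetAt_mono f (Fin.zero_le r) hc, le_refl c⟩
      left_le := fun _ h => (subsetAt_subset f r h.1).1
      le_right := fun _ h => h.2 })
    (fun _ _ h => Set.inter_subset_inter_left _ (subsetAt_mono f h))

/-- The part above `c` of a chain all of whose subsets contain `c`. -/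
def cutRight {i j : ThickLevel n m} (f : i ⟶ j) (c : Fin (n + 1)) (hc : c ∈ subsetAt f 0) :
    (⟨c⟩ : ThickLevel n m) ⟶ j :=
  homMk (fun r =>
    { I := subsetAt f r ∩ Set.Ici c
      left := ⟨subsetAt_mono f (Fin.zero_le r) hc, le_refl c⟩
      right := ⟨SimplicialThickening.Path.right _, (subsetAt_subset f 0 hc).2⟩
      left_le := fun _ h => h.2
      le_right := fun _ h => (subsetAt_subset f r h.1).2 })
    (fun _ _ h => Set.inter_subset_inter_left _ (subsetAt_mono f h))

theorem subsetAt_cutLeft {i j : ThickLevel n m} (f : i ⟶ j) (c : Fin (n + 1))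
    (hc : c ∈ subsetAt f 0) (r) : subsetAt (cutLeft f c hc) r = subsetAt f r ∩ Set.Iic c := rfl

theorem subsetAt_cutRight {i j : ThickLevel n m} (f : i ⟶ j) (c : Fin (n + 1))
    (hc : c ∈ subsetAt f 0) (r) : subsetAt (cutRight f c hc) r = subsetAt f r ∩ Set.Ici c := rfl

theorem cutLeft_comp_cutRight {i j : ThickLevel n m} (f : i ⟶ j) (c : Fin (n + 1))
    (hc : c ∈ subsetAt f 0) : cutLeft f c hc ≫ cutRight f c hc = f :=
  hom_ext fun r l => by
    rw [subsetAt_comp, subsetAt_cutLeft, subsetAt_cutRight, ← Set.inter_union_distrib_left,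
      Set.Iic_union_Ici, Set.inter_univ]

theorem mem_subsetAt_comp {i j k : ThickLevel n m} (f : i ⟶ j) (g : j ⟶ k) (r) :
    j.as ∈ subsetAt (f ≫ g) r :=
  Or.inl (SimplicialThickening.Path.right _)

theorem cutLeft_comp {i j k : ThickLevel n m} (f : i ⟶ j) (g : j ⟶ k) :
    cutLeft (f ≫ g) j.as (mem_subsetAt_comp f g 0) = f :=
  hom_ext fun r l => by
    rw [subsetAt_cutLeft, subsetAt_comp]
    constructor
    · rintro ⟨h | h, hl⟩
      · exact h
      · obtain rfl : l = j.as := le_antisymm hl (subsetAt_subset g r h).1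
        exact SimplicialThickening.Path.right _
    · exact fun h => ⟨Or.inl h, (subsetAt_subset f r h).2⟩

theorem cutRight_comp {i j k : ThickLevel n m} (f : i ⟶ j) (g : j ⟶ k) :
    cutRight (f ≫ g) j.as (mem_subsetAt_comp f g 0) = g :=
  hom_ext fun r l => by
    rw [subsetAt_cutRight, subsetAt_comp]
    constructor
    · rintro ⟨h | h, hl⟩
      · obtain rfl : l = j.as := le_antisymm (subsetAt_subset f r h).2 hl
        exact SimplicialThickening.Path.left _
      · exact h
    · exact fun h => ⟨Or.inr h, (subsetAt_subset g r h).1⟩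

theorem eq_of_le {i j : ThickLevel n m} (f : i ⟶ j) (h : j.as ≤ i.as) : i = j := by
  have h' := le_of_hom f
  cases i
  cases j
  exact congrArg ThickLevel.mk (le_antisymm h' h)

theorem eq_id {i : ThickLevel n m} (f : i ⟶ i) : f = 𝟙 i :=
  hom_ext fun r l => by
    rw [subsetAt_id]
    constructor
    · exact fun h => le_antisymm (subsetAt_subset f r h).2 (subsetAt_subset f r h).1
    · rintro rfl
      exact SimplicialThickening.Path.left _

/-- The decomposable chains `U_0 ⊆ ⋯ ⊆ U_m` from `i` to `j`: all `U_r`, equivalently `U_0`, contain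
a common element that is neither `i` nor `j`. These are the composites of shorter chains. -/
def decomposable (i j : Fin (n + 1)) :
    (nerve (SimplicialThickening.mk i ⟶ SimplicialThickening.mk j)).Subcomplex where
  obj m := {f | ∃ c, i < c ∧ c < j ∧ c ∈ subsetAt (m := m) (i := ⟨i⟩) (j := ⟨j⟩) f 0}
  map {m m'} μ f := by
    rintro ⟨c, h, h', hc⟩
    exact ⟨c, h, h', subsetAt_mono (m := m) (i := ⟨i⟩) (j := ⟨j⟩) f
      (Fin.zero_le (μ.unop.toOrderHom 0)) hc⟩

end ThickLevel

namespace LeveledTree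

open ThickLevel

variable {n : ℕ} {α : ComposableArrows AugmentedSimplexCategory n}
  {K Q : SimplicialOperad.{0}} {φ : SimplicialOperad.Hom K Q} {κ : Colour α → K.Col}
  {Ψ : ∀ m, Operad.OverHom (φ.col ∘ κ) (thickPresentation α m).operad (Q.level.obj m)}

variable (φ κ Ψ) in
/-- A lift along `φ : K ⟶ Q` of a morphism `Ψ : V_α ⟶ Q`, with a lift `κ` of its map on colours, on
the generators `(f, a)` given by chains `f : i ⟶ j` of length `j - i < d`, compatible with
simplicial operators, identities and composition. The values on longer chains are arbitrary. -/
structure PartialLift (d : ℕ) where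
  /-- The lift of the operation given by `(f, a)`. -/
  op {m : SimplexCategoryᵒᵖ} {i j : ThickLevel n m} (f : i ⟶ j) (a : Vertex α j.as) :
    (K.level.obj m).Op
  src_op {m : SimplexCategoryᵒᵖ} {i j : ThickLevel n m} (f : i ⟶ j) (a : Vertex α j.as)
    (hij : (j.as : ℕ) < i.as + d) : (K.level.obj m).src (op f a) =
      (preimage α ((proj n m).map f) a).map fun b => κ ⟨i.as, b⟩
  tgt_op {m : SimplexCategoryᵒᵖ} {i j : ThickLevel n m} (f : i ⟶ j) (a : Vertex α j.as)
    (hij : (j.as : ℕ) < i.as + d) : (K.level.obj m).tgt (op f a) = κ ⟨j.as, a⟩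
  act_op {m m' : SimplexCategoryᵒᵖ} (μ : m ⟶ m') {i j : ThickLevel n m} (f : i ⟶ j)
    (a : Vertex α j.as) (hij : (j.as : ℕ) < i.as + d) :
    K.act μ (op f a) = op ((operator n μ).map f) a
  op_id {m : SimplexCategoryᵒᵖ} (i : ThickLevel n m) (a : Vertex α i.as) :
    op (𝟙 i) a = (K.level.obj m).one (κ ⟨i.as, a⟩)
  -- Composites with an identity are excluded; they are covered by the unit laws.
  op_comp {m : SimplexCategoryᵒᵖ} {i j k : ThickLevel n m} (f : i ⟶ j) (g : j ⟶ k)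
    (a : Vertex α k.as) (hij : i.as < j.as) (hjk : j.as < k.as) (hik : (k.as : ℕ) < i.as + d) h :
    (K.level.obj m).comp (op g a) ((preimage α ((proj n m).map g) a).map (op f)) h = op (f ≫ g) a
  map_op {m : SimplexCategoryᵒᵖ} {i j : ThickLevel n m} (f : i ⟶ j) (a : Vertex α j.as)
    (hij : (j.as : ℕ) < i.as + d) : (φ.app m).toFun (op f a) = (Ψ m).toFun (edgeOp α f a)

/-- The induction starts with the chains of length `0`, the identities. -/
theorem nonempty_partialLift_one : Nonempty (PartialLift φ κ Ψ 1) := by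
  have key : ∀ {m : SimplexCategoryᵒᵖ} {i j : ThickLevel n m} (f : i ⟶ j)
      (hij : (j.as : ℕ) < i.as + 1), i = j := fun f hij => eq_of_le f (Nat.lt_succ_iff.1 hij)
  refine ⟨⟨fun {m i j} _ a => (K.level.obj m).one (κ ⟨j.as, a⟩), ?_, ?_, ?_, ?_, ?_, ?_⟩⟩
  · intro m i j f a hij
    obtain rfl := key f hij
    exact ((K.level.obj m).src_one _).trans
      (congrArg (List.map fun b => κ ⟨i.as, b⟩) (preimage_id α _ a)).symm
  · intro m i j f a hij
    exact (K.level.obj m).tgt_one _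
  · intro m m' μ i j f a hij
    exact K.act_one μ _
  · intro m i a
    rfl
  · intro m i j k f g a hij hjk hik
    exact absurd hik (by have : (i.as : ℕ) < j.as := hij; have : (j.as : ℕ) < k.as := hjk; omega)
  · intro m i j f a hij
    obtain rfl := key f hij
    rw [eq_id f, edgeOp_id, (φ.app m).map_one, (Ψ m).map_one]
    rfl

namespace PartialLift

variable {d : ℕ} (P : PartialLift φ κ Ψ d) {m : SimplexCategoryᵒᵖ}

theorem map_tgt_op {i j k : ThickLevel n m} (f : i ⟶ j) (g : j ⟶ k) (a : Vertex α k.as)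
    (hf : (j.as : ℕ) < i.as + d) (hg : (k.as : ℕ) < j.as + d) :
    ((preimage α ((proj n m).map g) a).map (P.op f)).map (K.level.obj m).tgt =
      (K.level.obj m).src (P.op g a) :=
  List.map_map.trans ((List.map_congr_left fun b _ => P.tgt_op f b hf).trans
    (P.src_op g a hg).symm)

/-- The operadic composite of the lifts of `f` and `g`, the value forced on `f ≫ g`. -/
def composite {i j k : ThickLevel n m} (f : i ⟶ j) (g : j ⟶ k) (a : Vertex α k.as)
    (hf : (j.as : ℕ) < i.as + d) (hg : (k.as : ℕ) < j.as + d) : (K.level.obj m).Op :=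
  (K.level.obj m).comp (P.op g a) ((preimage α ((proj n m).map g) a).map (P.op f))
    (P.map_tgt_op f g a hf hg)

theorem src_composite {i j k : ThickLevel n m} (f : i ⟶ j) (g : j ⟶ k) (h : i.as ⟶ k.as)
    (a : Vertex α k.as)
    (hf : (j.as : ℕ) < i.as + d) (hg : (k.as : ℕ) < j.as + d) :
    (K.level.obj m).src (P.composite f g a hf hg) =
      (preimage α h a).map fun b => κ ⟨i.as, b⟩ := by
  refine ((K.level.obj m).src_comp _ _ _).trans ((List.flatMap_map _ _ _).trans ?_)
  refine Eq.trans ?_ (congrArg (List.map _)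
    (preimage_flatMap α ((proj n m).map f) ((proj n m).map g) h a))
  exact (List.flatMap_congr fun b _ => P.src_op f b hf).trans List.map_flatMap.symm

theorem tgt_composite {i j k : ThickLevel n m} (f : i ⟶ j) (g : j ⟶ k) (a : Vertex α k.as)
    (hf : (j.as : ℕ) < i.as + d) (hg : (k.as : ℕ) < j.as + d) :
    (K.level.obj m).tgt (P.composite f g a hf hg) = κ ⟨k.as, a⟩ :=
  ((K.level.obj m).tgt_comp _ _ _).trans (P.tgt_op g a hg)

theorem act_composite {m' : SimplexCategoryᵒᵖ} (μ : m ⟶ m') {i j k : ThickLevel n m}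
    (f : i ⟶ j) (g : j ⟶ k) (a : Vertex α k.as)
    (hf : (j.as : ℕ) < i.as + d) (hg : (k.as : ℕ) < j.as + d) :
    K.act μ (P.composite f g a hf hg) =
      P.composite ((operator n μ).map f) ((operator n μ).map g) a hf hg := by
  refine (K.act_opComp μ _ _ _).trans (Operad.comp_congr _ (P.act_op μ g a hg) ?_ _ _)
  exact List.map_map.trans (List.map_congr_left fun b _ => P.act_op μ f b hf)

theorem map_composite {i j k : ThickLevel n m} (f : i ⟶ j) (g : j ⟶ k) (a : Vertex α k.as)
    (hf : (j.as : ℕ) < i.as + d) (hg : (k.as : ℕ) < j.as + d) :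
    (φ.app m).toFun (P.composite f g a hf hg) = (Ψ m).toFun (edgeOp α (f ≫ g) a) := by
  rw [← edgeOp_comp α f g a (map_tgt_edgeOp α f g a), (Ψ m).map_comp]
  refine ((φ.app m).map_comp _ _ _).trans (Operad.comp_congr _ (P.map_op g a hg) ?_ _ _)
  exact List.map_map.trans ((List.map_congr_left fun b _ => P.map_op f b hf).trans
    List.map_map.symm)

/-- Two ways to cut a chain into two pieces that have a common refinement into three pieces force
the same value, by associativity. -/
theorem composite_comp {i j k l : ThickLevel n m} (f : i ⟶ j) (g : j ⟶ k) (h : k ⟶ l)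
    (a : Vertex α l.as) (hij : i.as < j.as) (hjk : j.as < k.as) (hkl : k.as < l.as)
    (hik : (k.as : ℕ) < i.as + d) (hjl : (l.as : ℕ) < j.as + d)
    (hij' : (j.as : ℕ) < i.as + d) (hkl' : (l.as : ℕ) < k.as + d) :
    P.composite (f ≫ g) h a hik hkl' = P.composite f (g ≫ h) a hij' hjl := by
  have hjk' : (k.as : ℕ) < j.as + d := by
    have : (k.as : ℕ) < l.as := hkl
    omega
  -- the data for the associativity law: above every `b` in the fibre of `h`, the lift of `g` at `b`
  -- and the lifts of `f` at the fibre of `g` over `b`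
  let L : List (Σ' (f : (K.level.obj m).Op) (hs : List (K.level.obj m).Op),
      hs.map (K.level.obj m).tgt = (K.level.obj m).src f) :=
    (preimage α ((proj n m).map h) a).map fun b =>
      ⟨P.op g b, (preimage α ((proj n m).map g) b).map (P.op f), P.map_tgt_op f g b hij' hjk'⟩
  have e1 : L.map (fun p => p.1) = (preimage α ((proj n m).map h) a).map (P.op g) := List.map_map
  have e2 : L.flatMap (fun p => p.2.1) = (preimage α ((proj n m).map (g ≫ h)) a).map (P.op f) := by
    refine Eq.trans ?_ (congrArg (List.map _)
      (preimage_flatMap α ((proj n m).map g) ((proj n m).map h) _ a))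
    exact (List.flatMap_map ..).trans List.map_flatMap.symm
  have e3 : L.map (fun p => (K.level.obj m).comp p.1 p.2.1 p.2.2) =
      (preimage α ((proj n m).map h) a).map (P.op (f ≫ g)) :=
    List.map_map.trans (List.map_congr_left fun b _ => P.op_comp f g b hij hjk hik _)
  have e4 : (L.map fun p => p.1).map (K.level.obj m).tgt = (K.level.obj m).src (P.op h a) := by
    rw [e1]; exact P.map_tgt_op g h a hjk' hkl'
  have key := (K.level.obj m).assoc (P.op h a) L e4
  refine (Operad.comp_congr _ rfl e3.symm _ ?_).trans (key.trans
    (Operad.comp_congr _ ?_ e2 _ _))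
  · rw [e3]; exact P.map_tgt_op _ h a hik hkl'
  · refine (Operad.comp_congr _ rfl e1 _ (P.map_tgt_op g h a hjk' hkl')).trans ?_
    exact P.op_comp g h a hjk hkl hjl _

theorem composite_congr {i j k : ThickLevel n m} {f f' : i ⟶ j} {g g' : j ⟶ k}
    (hf' : f = f') (hg' : g = g') (a : Vertex α k.as)
    (hf : (j.as : ℕ) < i.as + d) (hg : (k.as : ℕ) < j.as + d) :
    P.composite f g a hf hg = P.composite f' g' a hf hg := by
  subst hf' hg'; rfl

/-- The composite does not depend on the place where a chain is cut. -/
theorem composite_cut {i j : ThickLevel n m} (f : i ⟶ j) (a : Vertex α j.as)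
    (hij : (j.as : ℕ) = i.as + d) {c c' : Fin (n + 1)} (hc : c ∈ subsetAt f 0)
    (hc' : c' ∈ subsetAt f 0) (hic : i.as < c) (hcj : c < j.as) (hic' : i.as < c')
    (hcj' : c' < j.as) :
    P.composite (cutLeft f c hc) (cutRight f c hc) a
      (show (c : ℕ) < i.as + d from hij ▸ hcj)
      (show (j.as : ℕ) < c + d from hij ▸ Nat.add_lt_add_right hic d) =
    P.composite (cutLeft f c' hc') (cutRight f c' hc') a
      (show (c' : ℕ) < i.as + d from hij ▸ hcj')
      (show (j.as : ℕ) < c' + d from hij ▸ Nat.add_lt_add_right hic' d) := by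
  wlog h : c < c' generalizing c c'
  · obtain rfl | h' := eq_or_lt_of_le (not_lt.1 h)
    · rfl
    · exact (this hc' hc hic' hcj' hic hcj h').symm
  have hcr : c' ∈ subsetAt (cutRight f c hc) 0 := ⟨hc', h.le⟩
  have hcl : c ∈ subsetAt (cutLeft f c' hc') 0 := ⟨hc, h.le⟩
  let mid := cutLeft (cutRight f c hc) c' hcr
  have e1 : mid ≫ cutRight f c' hc' = cutRight f c hc := by
    refine Eq.trans ?_ (cutLeft_comp_cutRight (cutRight f c hc) c' hcr)
    congr 1
    refine hom_ext fun r l => ?_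
    simp only [subsetAt_cutRight, Set.mem_inter_iff, Set.mem_Ici]
    exact ⟨fun h' => ⟨⟨h'.1, h.le.trans h'.2⟩, h'.2⟩, fun h' => ⟨h'.1.1, h'.2⟩⟩
  have e2 : cutLeft f c hc ≫ mid = cutLeft f c' hc' := by
    refine Eq.trans ?_ (cutLeft_comp_cutRight (cutLeft f c' hc') c hcl)
    congr 1
    · refine hom_ext fun r l => ?_
      simp only [subsetAt_cutLeft, Set.mem_inter_iff, Set.mem_Iic]
      exact ⟨fun h' => ⟨⟨h'.1, h'.2.trans h.le⟩, h'.2⟩, fun h' => ⟨h'.1.1, h'.2⟩⟩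
    · refine hom_ext fun r l => ?_
      simp only [mid, subsetAt_cutLeft, subsetAt_cutRight, Set.mem_inter_iff, Set.mem_Iic,
        Set.mem_Ici]
      tauto
  have h1 : (c : ℕ) < i.as + d := hij ▸ hcj
  have h2 : (j.as : ℕ) < c + d := hij ▸ Nat.add_lt_add_right hic d
  have h1' : (c' : ℕ) < i.as + d := hij ▸ hcj'
  have h2' : (j.as : ℕ) < c' + d := hij ▸ Nat.add_lt_add_right hic' d
  exact (P.composite_congr rfl e1.symm a h1 h2).trans ((P.composite_comp (cutLeft f c hc) mid
    (cutRight f c' hc') a hic h hcj' h1' h2 h1 h2').symm.trans (P.composite_congr e2 rfl a h1' h2'))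

/-- The values that a partial lift forces on the decomposable chains of length `d`. By
`composite_cut`, the choice of the place where a chain is cut does not matter, and hence they form
a simplicial map. -/
noncomputable def decomposableMap {i j : Fin (n + 1)} (hij : (j : ℕ) = i + d) (h : i ⟶ j)
    (a : Vertex α j) :
    (decomposable i j : SSet.{0}) ⟶
      K.space ((preimage α h a).map fun b => κ ⟨i, b⟩) (κ ⟨j, a⟩) where
  app m := ↾fun f =>
    have hc := f.2.choose_spec
    ⟨P.composite (m := m) (i := ⟨i⟩) (k := ⟨j⟩) (cutLeft (i := ⟨i⟩) (j := ⟨j⟩) f.1 _ hc.2.2)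
      (cutRight f.1 _ hc.2.2) a
      (show (f.2.choose : ℕ) < i + d from hij ▸ hc.2.1)
      (show (j : ℕ) < f.2.choose + d from hij ▸ Nat.add_lt_add_right hc.1 d),
      P.src_composite _ _ h a _ _, P.tgt_composite _ _ a _ _⟩
  naturality m m' μ := by
    ext f
    have hc := f.2.choose_spec
    have h1 : (f.2.choose : ℕ) < i + d := hij ▸ hc.2.1
    have h2 : (j : ℕ) < f.2.choose + d := hij ▸ Nat.add_lt_add_right hc.1 d
    refine Subtype.ext (Eq.trans ?_ (P.act_composite μ (i := ⟨i⟩) (k := ⟨j⟩) (cutLeft f.1 _ hc.2.2)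
      (cutRight f.1 _ hc.2.2) a h1 h2).symm)
    have hc' := ((decomposable i j : SSet.{0}).map μ f).2.choose_spec
    exact P.composite_cut (i := ⟨i⟩) (j := ⟨j⟩) (((decomposable i j : SSet.{0}).map μ f).1) a hij
      hc'.2.2 (subsetAt_mono (m := m) (i := ⟨i⟩) (j := ⟨j⟩) f.1
        (Fin.zero_le (μ.unop.toOrderHom 0)) hc.2.2) hc'.1 hc'.2.1 hc.1 hc.2.1

/-- The lifting problem for the chains of length `d` from `i` to `j`: the inclusion of the
decomposable chains is a monomorphism, hence `φ` lifts against it on the spaces of operations. -/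
theorem exists_extension
    (hφ : ∀ x y, (MorphismProperty.monomorphisms SSet.{0}).rlp (φ.mapSpace x y))
    (hΨ : ∀ ⦃m m' : SimplexCategoryᵒᵖ⦄ (μ : m ⟶ m') (x : (thickPresentation α m).operad.Op),
      Q.act μ ((Ψ m).toFun x) = (Ψ m').toFun ((V α).act μ x))
    {i j : Fin (n + 1)} (hij : (j : ℕ) = i + d) (h : i ⟶ j) (a : Vertex α j) :
    ∃ l : nerve (SimplicialThickening.mk i ⟶ SimplicialThickening.mk j) ⟶
        K.space ((preimage α h a).map fun b => κ ⟨i, b⟩) (κ ⟨j, a⟩),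
      (∀ (m : SimplexCategoryᵒᵖ) (f : (⟨i⟩ : ThickLevel n m) ⟶ ⟨j⟩),
        (φ.app m).toFun (l.app m f).1 = (Ψ m).toFun (edgeOp α f a)) ∧
      ∀ (m : SimplexCategoryᵒᵖ) (c : ThickLevel n m) (f : (⟨i⟩ : ThickLevel n m) ⟶ c)
        (g : c ⟶ ⟨j⟩) (_ : i < c.as) (_ : c.as < j) hf hg,
        (l.app m (f ≫ g)).1 = P.composite f g a hf hg := by
  let b : nerve (SimplicialThickening.mk i ⟶ SimplicialThickening.mk j) ⟶
      Q.space (((preimage α h a).map fun b => κ ⟨i, b⟩).map φ.col) (φ.col (κ ⟨j, a⟩)) :=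
    { app m := ↾fun f => ⟨(Ψ m).toFun (edgeOp (m := m) α (i := ⟨i⟩) (j := ⟨j⟩) f a), by
          refine ((Ψ m).src_toFun _).trans ((congrArg _ (src_edgeOp α _ a)).trans ?_)
          exact List.map_map.trans (List.map_map (g := φ.col) (f := fun b => κ ⟨i, b⟩)).symm, by
          refine ((Ψ m).tgt_toFun _).trans ((congrArg _ (tgt_edgeOp α _ a)).trans ?_)
          rfl⟩
      naturality m m' μ := by
        ext f
        refine Subtype.ext (Eq.symm ((hΨ μ _).trans (congrArg (Ψ m').toFun ?_)))
        exact thickMap_edgeOp (m := m) α μ (i := ⟨i⟩) (j := ⟨j⟩) f a }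
  have sq : CommSq (P.decomposableMap hij h a) (decomposable i j).ι (φ.mapSpace _ _) b := ⟨by
    ext m f
    have hc := f.2.choose_spec
    have h1 : (f.2.choose : ℕ) < i + d := hij ▸ hc.2.1
    have h2 : (j : ℕ) < f.2.choose + d := hij ▸ Nat.add_lt_add_right hc.1 d
    refine Subtype.ext ((P.map_composite (i := ⟨i⟩) (k := ⟨j⟩) (cutLeft f.1 _ hc.2.2)
      (cutRight f.1 _ hc.2.2) a h1 h2).trans ?_)
    rw [cutLeft_comp_cutRight]
    rfl⟩
  have := hφ ((preimage α h a).map fun b => κ ⟨i, b⟩) (κ ⟨j, a⟩) (decomposable i j).ι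
    (MorphismProperty.monomorphisms.infer_property _)
  refine ⟨sq.lift, fun m f => ?_, fun m c f g hic hcj hf hg => ?_⟩
  · exact congrArg Subtype.val (ConcreteCategory.congr_hom (NatTrans.congr_app sq.fac_right m) f)
  · have hD : f ≫ g ∈ (decomposable i j).obj m := ⟨c.as, hic, hcj, mem_subsetAt_comp f g 0⟩
    have hs := hD.choose_spec
    refine Eq.trans (congrArg Subtype.val (ConcreteCategory.congr_hom
      (NatTrans.congr_app sq.fac_left m) ⟨f ≫ g, hD⟩)) ?_
    exact (P.composite_cut (f ≫ g) a hij hs.2.2 (mem_subsetAt_comp f g 0) hs.1 hs.2.1 hic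
      hcj).trans (P.composite_congr (cutLeft_comp f g) (cutRight_comp f g) a hf hg)

theorem nonempty_succ (P : PartialLift φ κ Ψ d)
    (hφ : ∀ x y, (MorphismProperty.monomorphisms SSet.{0}).rlp (φ.mapSpace x y))
    (hΨ : ∀ ⦃m m' : SimplexCategoryᵒᵖ⦄ (μ : m ⟶ m') (x : (thickPresentation α m).operad.Op),
      Q.act μ ((Ψ m).toFun x) = (Ψ m').toFun ((V α).act μ x)) (hd : 0 < d) :
    Nonempty (PartialLift φ κ Ψ (d + 1)) := by
  have hle : ∀ {i j : Fin (n + 1)} (hij : (j : ℕ) = i + d), i ≤ j := fun hij =>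
    Fin.le_def.2 (hij ▸ Nat.le_add_right _ _)
  choose l hl hl' using fun (i j : Fin (n + 1)) (hij : (j : ℕ) = i + d) (a : Vertex α j) =>
    P.exists_extension hφ hΨ hij (homOfLE (hle hij)) a
  -- the composition law for total length `d` is the second property of the extensions; for
  -- shorter chains nothing changes
  let op' : ∀ {m : SimplexCategoryᵒᵖ} {i j : ThickLevel n m} (f : i ⟶ j) (a : Vertex α j.as),
      (K.level.obj m).Op := fun {m i j} f a =>
    if hij : (j.as : ℕ) = i.as + d then ((l i.as j.as hij a).app m f).1 else P.op f a
  have op_eq : ∀ {m : SimplexCategoryᵒᵖ} {i j : ThickLevel n m} (f : i ⟶ j) (a : Vertex α j.as)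
      (hij : (j.as : ℕ) = i.as + d), op' f a = ((l i.as j.as hij a).app m f).1 :=
    fun f a hij => dif_pos hij
  have op_ne : ∀ {m : SimplexCategoryᵒᵖ} {i j : ThickLevel n m} (f : i ⟶ j) (a : Vertex α j.as)
      (hij : (j.as : ℕ) ≠ i.as + d), op' f a = P.op f a :=
    fun f a hij => dif_neg hij
  refine ⟨⟨op', ?_, ?_, ?_, ?_, ?_, ?_⟩⟩
  · intro m i j f a h
    by_cases hij : (j.as : ℕ) = i.as + d
    · rw [op_eq f a hij]
      exact ((l i.as j.as hij a).app m f).2.1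
    · rw [op_ne f a hij]
      exact P.src_op f a (by omega)
  · intro m i j f a h
    by_cases hij : (j.as : ℕ) = i.as + d
    · rw [op_eq f a hij]
      exact ((l i.as j.as hij a).app m f).2.2
    · rw [op_ne f a hij]
      exact P.tgt_op f a (by omega)
  · intro m m' μ i j f a h
    by_cases hij : (j.as : ℕ) = i.as + d
    · rw [op_eq f a hij, op_eq ((operator n μ).map f) a hij]
      exact congrArg Subtype.val
        (ConcreteCategory.congr_hom ((l i.as j.as hij a).naturality μ) f).symm
    · rw [op_ne f a hij, op_ne ((operator n μ).map f) a hij]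
      exact P.act_op μ f a (by omega)
  · intro m i a
    rw [op_ne _ a (by omega)]
    exact P.op_id i a
  · intro m i j k f g a hij hjk h hh
    have hij' : (i.as : ℕ) < j.as := hij
    have hjk' : (j.as : ℕ) < k.as := hjk
    have e : op' g a = P.op g a := op_ne g a (by omega)
    have e' : (preimage α ((proj n m).map g) a).map (op' f) =
        (preimage α ((proj n m).map g) a).map (P.op f) :=
      List.map_congr_left fun b _ => op_ne f b (by omega)
    refine (Operad.comp_congr _ e e' _ (P.map_tgt_op f g a (by omega) (by omega))).trans ?_
    by_cases hik : (k.as : ℕ) = i.as + d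
    · rw [op_eq (f ≫ g) a hik]
      have h1 : (j.as : ℕ) < i.as + d := by omega
      have h2 : (k.as : ℕ) < j.as + d := by omega
      exact (hl' i.as k.as hik a m j f g hij hjk h1 h2).symm
    · rw [op_ne (f ≫ g) a hik]
      exact P.op_comp f g a hij hjk (by omega) _
  · intro m i j f a h
    by_cases hij : (j.as : ℕ) = i.as + d
    · rw [op_eq f a hij]
      exact hl i.as j.as hij a m f
    · rw [op_ne f a hij]
      exact P.map_op f a (by omega)

/-- Compatibility with composition, including composites with identities. -/
theorem op_comp_of_hom {i j k : ThickLevel n m} (f : i ⟶ j) (g : j ⟶ k)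
    (a : Vertex α k.as) (hik : (k.as : ℕ) < i.as + d) h :
    (K.level.obj m).comp (P.op g a) ((preimage α ((proj n m).map g) a).map (P.op f)) h =
      P.op (f ≫ g) a := by
  have hij := le_of_hom f
  have hjk := le_of_hom g
  obtain hij | hij := hij.eq_or_lt
  · obtain rfl := eq_of_le f hij.ge
    obtain rfl := eq_id f
    rw [Category.id_comp]
    refine Eq.trans (Operad.comp_congr _ rfl ?_ _ ?_) ((K.level.obj m).comp_one _)
    · rw [P.src_op g a hik]
      exact (List.map_congr_left fun b _ => P.op_id i b).trans List.map_map.symm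
    · simp [Function.comp_def, Operad.tgt_one]
  · obtain hjk | hjk := hjk.eq_or_lt
    · obtain rfl := eq_of_le g hjk.ge
      obtain rfl := eq_id g
      rw [Category.comp_id]
      refine Eq.trans (Operad.comp_congr _ ?_ ?_ _ ?_) ((K.level.obj m).one_comp _)
      · rw [P.op_id, P.tgt_op f a hik]
      · exact congrArg (List.map _) (preimage_id α _ a)
      · simp [Operad.src_one]
    · exact P.op_comp f g a hij hjk hik h

end PartialLift

theorem nonempty_partialLift
    (hφ : ∀ x y, (MorphismProperty.monomorphisms SSet.{0}).rlp (φ.mapSpace x y))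
    (hΨ : ∀ ⦃m m' : SimplexCategoryᵒᵖ⦄ (μ : m ⟶ m') (x : (thickPresentation α m).operad.Op),
      Q.act μ ((Ψ m).toFun x) = (Ψ m').toFun ((V α).act μ x)) (d : ℕ) :
    Nonempty (PartialLift φ κ Ψ (d + 1)) := by
  induction d with
  | zero => exact nonempty_partialLift_one
  | succ d ih =>
    obtain ⟨P⟩ := ih
    exact P.nonempty_succ hφ hΨ d.succ_pos

/-- Every lift of the map on colours extends to a lift of the whole morphism, for `φ` a trivial
fibration on spaces of operations. -/
theorem exists_lift_of_col
    (hφ : ∀ x y, (MorphismProperty.monomorphisms SSet.{0}).rlp (φ.mapSpace x y))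
    (hΨ : ∀ ⦃m m' : SimplexCategoryᵒᵖ⦄ (μ : m ⟶ m') (x : (thickPresentation α m).operad.Op),
      Q.act μ ((Ψ m).toFun x) = (Ψ m').toFun ((V α).act μ x)) :
    ∃ F : SimplicialOperad.Hom (V α) K, F.col = κ ∧
      ∀ m x, (φ.app m).toFun ((F.app m).toFun x) = (Ψ m).toFun x := by
  -- every chain has length at most `n`
  obtain ⟨P⟩ := nonempty_partialLift hφ hΨ n
  have hlt : ∀ i j : Fin (n + 1), (j : ℕ) < i + (n + 1) := by omega
  let F : ∀ m, Operad.OverHom κ (thickPresentation α m).operad (K.level.obj m) := fun m =>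
    edgeLift α (K.level.obj m) κ (fun _ _ f a => P.op f a) (fun _ _ f a => P.src_op f a (hlt _ _))
      (fun _ _ f a => P.tgt_op f a (hlt _ _)) (fun i a => P.op_id i a)
      (fun _ _ _ f g a h => P.op_comp_of_hom f g a (hlt _ _) h)
  have hF : ∀ {m : SimplexCategoryᵒᵖ} {i j : ThickLevel n m} (f : i ⟶ j) (a : Vertex α j.as),
      (F m).toFun (edgeOp α f a) = P.op f a := fun f a => edgeLift_edgeOp α _ _ _ _ _ _ _ f a
  refine ⟨⟨κ, F, fun {m m'} μ x => ?_⟩, rfl, fun m x => ?_⟩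
  · suffices h : Operad.OverHom.trans (F m) (K.level.map μ) κ rfl =
        Operad.OverHom.trans (thickMap α μ) (F m') κ rfl from
      congrArg (fun G => Operad.OverHom.toFun G x) h
    refine edge_hom_ext α fun f a => ?_
    refine (congrArg (K.act μ) (hF f a)).trans ((P.act_op μ f a (hlt _ _)).trans ?_)
    exact ((congrArg (F m').toFun (thickMap_edgeOp α μ f a)).trans
      (hF ((operator n μ).map f) a)).symm
  · suffices h : Operad.OverHom.trans (F m) (φ.app m) (φ.col ∘ κ) rfl = Ψ m from
      congrArg (fun G => Operad.OverHom.toFun G x) h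
    refine edge_hom_ext α fun f a => ?_
    exact (congrArg (φ.app m).toFun (hF f a)).trans (P.map_op f a (hlt _ _))

end LeveledTree

namespace SimplicialOperad

/-- The map on colours of a trivial fibration is surjective: it is essentially surjective, and an
isofibration lifts the isomorphisms. -/
theorem col_surjective_of_trivialFibration {K Q : SimplicialOperad.{u}} {φ : K ⟶ Q}
    (h : (Hom.hoFunctor φ).IsEquivalence) (h' : IsIsofibration (Hom.hoFunctor φ)) :
    Function.Surjective (Hom.col φ) := by
  intro c
  obtain ⟨a', e', h, -⟩ := h' _ _ ((Hom.hoFunctor φ).objObjPreimageIso ⟨c⟩)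
  exact ⟨a'.col, congrArg HoCat.col h⟩

end SimplicialOperad

theorem LeveledTree.isCofibrant_V {n : ℕ} (α : ComposableArrows AugmentedSimplexCategory n) :
    IsCofibrant (V α) := by
  refine ⟨fun K Q φ hφ => ⟨fun {f ψ} sq => ⟨⟨?_⟩⟩⟩⟩
  obtain ⟨⟨hfib, hiso⟩, hw, heq⟩ := hφ
  have hsurj := SimplicialOperad.col_surjective_of_trivialFibration heq hiso
  choose κ hκ using fun c => hsurj (SimplicialOperad.Hom.col ψ c)
  have h : ∃ F : V α ⟶ K, F ≫ φ = ψ := by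
    obtain ⟨c, Ψ, hΨ⟩ := ψ
    obtain rfl : SimplicialOperad.Hom.col φ ∘ κ = c := funext hκ
    obtain ⟨⟨c, F, nat⟩, rfl, hF'⟩ := exists_lift_of_col (φ := φ) (κ := κ) (Ψ := Ψ)
      (fun x y => SSet.IsKanFibration.rlp_monomorphisms (hfib x y) (hw x y)) (fun _ _ => hΨ)
    refine ⟨⟨c, F, nat⟩, ?_⟩
    exact SimplicialOperad.Hom.ext rfl
      (heq_of_eq (funext fun m => Operad.OverHom.ext (funext (hF' m))))
  exact ⟨h.choose, Limits.initialIsInitial.hom_ext _ _, h.choose_spec⟩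

theorem mainTheorem9 (n : ℕ)
    (α : (nerve AugmentedSimplexCategory).obj (op (SimplexCategory.mk n))) :
    IsCofibrant (LeveledTree.V α) ∧ WeakEquivalence (LeveledTree.augmentation α) :=
  ⟨LeveledTree.isCofibrant_V α, LeveledTree.weakEquivalence_augmentation α⟩
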